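/- **Model.** Let $\lambda>0$, $0<\gamma<1$, $0<G\le 1$, $K>0$, $R\ge 0$, and put $\Lambda=\lambda\gamma K$, $\kappa=G\pi(1-\gamma)/(\gamma K)$. A source sits at $(-R/2,0)$ and a destination at $(R/2,0)$. Relays form a homogeneous Poisson point process of intensity $(1-\gamma)\lambda$ in the plane. Given the relay locations, a transmission from node $a$ to node $b$ in a time slot $t$ succeeds with probability $G\exp(-\lambda\gamma K|a-b|^2)$, independently over all slots and ordered pairs of nodes. Fix $m\ge 1$. A relay set is an ordered $m$-tuple $Z_m$ of distinct relays; it defines a route from source to destination with $m+1$ hops of lengths $r_1,\dots,r_{m+1}$, and $d_m(Z_m)=\sum_{i=1}^{m+1} r_i^2$. A relay set that completes the forwarding is called a potential relay set, $N_m$ is the number of potential relay sets, and outage is the event $N_m=0$. For $\mathbf n=(n_1,\dots,n_{m+1})$ with integers $n_i\ge 1$ write $$e_{\mathbf n}=\frac{\pi^m(1-\gamma)^m}{\gamma^mK^m}\,G^{\sum_i n_i}\,\frac{\exp\left(-\frac{\Lambda R^2}{\sum_{i}1/n_i}\right)}{\left(\prod_{i}n_i\right)\left(\sum_{i}\frac1{n_i}\right)}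 .$$ **Corollary 1.** (1) Suppose that each hop is transmitted once (hop $i$ of every route in a fixed slot $s_i$) and that only relay sets with $d_m(Z_m)\le D_m$ are used, where $D_m\ge R^2/(m+1)$. Then the expected number of potential relay sets is $$\mathbb E(N_m)=\frac{G\kappa^m}{m+1}\left\{\exp\left(-\frac{\Lambda R^2}{m+1}\right)-\exp(-\Lambda D_m)\sum_{i=0}^{m-1}\frac1{i!}\left(\Lambda\left(D_m-\frac{R^2}{m+1}\right)\right)^i\right\},$$ and the outage probability satisfies $p_{\mathrm{out}}^{(m)}\ge\exp(-\mathbb E(N_m))$. (2) Suppose that hop $i$ of every route is attempted $k_i$ times, in a fixed set of $k_i$ slots, and that a relay set completes the forwarding when each hop succeeds in at least one of its attempts. Then the expected number of potential relay sets is $$\mathbb E_{\mathbf k}(N_m)=\sum_{\mathbf 1\preceq\mathbf n\preceq\mathbf k}(-1)^{m+1+\sum_i n_i}\prod_{i=1}^{m+1}\binom{k_i}{n_i}\,e_{\mathbf n},$$ and the outage probability satisfies $q_{\mathbf k}\ge\exp(-\mathbb E_{\mathbf k}(N_m))$. (3) Suppose that $M$ attempts are allowed in total, i.e. a relay set completes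 the forwarding when there are slots $1\le t_1<\dots<t_{m+1}\le M$ such that hop $i$ succeeds in slot $t_i$ for every $i$. Then the expected number of potential relay sets is $$\mathbb E_M(N_m)=\sum_{\substack{\mathbf k\succeq\mathbf 1\\ \sum_i k_i\le M}}(-1)^{m+1+\sum_i k_i}\sum_{\substack{\mathbf j\succeq\mathbf k\\ \sum_i j_i\le M}}\ \prod_{l=1}^{m+1}\binom{j_l-1}{k_l-1}\ e_{\mathbf k},$$ and the outage probability satisfies $q_M\ge\exp(-\mathbb E_M(N_m))$. -/

import Mathlib

open MeasureTheory ProbabilityTheory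
open scoped ENNReal

noncomputable section

namespace Multihop

/-- The plane with its Euclidean metric and Lebesgue measure. -/
abbrev Plane : Type := EuclideanSpace ℝ (Fin 2)

/-- Parameters of the network: `lam` is the density of all potential transmitters, `gam` the
portion of active transmitters, `G` and `K` the constants of the exponential single-hop success
probability, `R` the distance from the source to the destination. -/
structure Params where
  lam : ℝ
  gam : ℝ
  G : ℝ
  K : ℝ
  R : ℝ

/-- `Λ = λ γ K`. -/
def Params.bigLam (p : Params) : ℝ := p.lam * p.gam * p.K

/-- `κ = G π (1 - γ) / (γ K)`. -/
def Params.kappa (p : Params) : ℝ := p.G * Real.pi * (1 - p.gam) / (p.gam * p.K)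

/-- Density of the pool of relays, `(1 - γ) λ`. -/
def Params.relayDensity (p : Params) : ℝ := (1 - p.gam) * p.lam

/-- Success probability of one transmission over distance `r`, with active transmitters of
density `λ γ`. -/
def Params.g0 (p : Params) (r : ℝ) : ℝ := p.G * Real.exp (-(p.lam * p.gam) * p.K * r ^ 2)

/-- The nodes a typical source-destination pair can use: the source, the destination, and the
relays, which are enumerated by `ℕ`. -/
inductive Node where
  | source : Node
  | dest : Node
  | relay : ℕ → Node

section Model

variable {Ω : Type*}

/-- Number of indices `n` such that the point `X n` lies in `A`. -/
def count (X : ℕ → Ω → Plane) (A : Set Plane) (ω : Ω) : ℕ∞ := {n : ℕ | X n ω ∈ A}.encard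

/-- The random points `X 0, X 1, …` form a homogeneous Poisson point process of intensity `ρ`
in the plane. -/
structure IsHPPP [MeasurableSpace Ω] (P : Measure Ω) (ρ : ℝ) (X : ℕ → Ω → Plane) : Prop where
  measurable : ∀ n, Measurable (X n)
  count_law : ∀ A : Set Plane, MeasurableSet A → volume A ≠ ∞ → ∀ j : ℕ,
    P {ω | count X A ω = j} = ENNReal.ofReal
      (Real.exp (-(ρ * volume.real A)) * (ρ * volume.real A) ^ j / (j.factorial : ℝ))
  count_indep : ∀ (N : ℕ) (A : Fin N → Set Plane), (∀ i, MeasurableSet (A i)) →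
    Pairwise (fun i j => Disjoint (A i) (A j)) → iIndepFun (fun i => count X (A i)) P

/-- The random network: the relays form a homogeneous Poisson process of intensity `(1 - γ) λ`;
the channel states `U (t, a, b)`, one for every time slot `t` and every ordered pair of nodes
`(a, b)`, are i.i.d. uniform on `[0, 1]` and independent of the relay locations. -/
structure IsNetwork [MeasurableSpace Ω] (p : Params) (P : Measure Ω) (X : ℕ → Ω → Plane)
    (U : ℕ × Node × Node → Ω → ℝ) : Prop where
  relays : IsHPPP P p.relayDensity X
  channel_measurable : ∀ q, Measurable (U q)
  channel_law : ∀ q, P.map (U q) = volume.restrict (Set.Icc (0 : ℝ) 1)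
  channel_indep : iIndepFun U P
  indep : IndepFun (fun ω n => X n ω) (fun ω q => U q ω) P

/-- Location of a node; the source is at `(-R/2, 0)`, the destination at `(R/2, 0)`. -/
def pos (p : Params) (X : ℕ → Ω → Plane) (ω : Ω) : Node → Plane
  | Node.source => !₂[-p.R / 2, 0]
  | Node.dest => !₂[p.R / 2, 0]
  | Node.relay n => X n ω

/-- The transmission from `a` to `b` in slot `t` succeeds. Given the locations, this has
probability `g0 (|a - b|)`, independently over slots and ordered pairs of nodes. -/
def Success (p : Params) (X : ℕ → Ω → Plane) (U : ℕ × Node × Node → Ω → ℝ)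
    (t : ℕ) (a b : Node) (ω : Ω) : Prop :=
  U (t, a, b) ω ≤ p.g0 (dist (pos p X ω a) (pos p X ω b))

variable {m : ℕ}

/-- Transmitter of hop `i` of the route `source → z 0 → ⋯ → z (m - 1) → dest`. -/
def hopTx (z : Fin m → ℕ) : Fin (m + 1) → Node :=
  Fin.cases Node.source (fun j => Node.relay (z j))

/-- Receiver of hop `i` of the route `source → z 0 → ⋯ → z (m - 1) → dest`. -/
def hopRx (z : Fin m → ℕ) : Fin (m + 1) → Node :=
  Fin.lastCases Node.dest (fun j => Node.relay (z j))

/-- `d_m`, the sum of the squares of the hop distances of the route through the relays `z`. -/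
def routeSqDist (p : Params) (X : ℕ → Ω → Plane) (z : Fin m → ℕ) (ω : Ω) : ℝ :=
  ∑ i : Fin (m + 1), dist (pos p X ω (hopTx z i)) (pos p X ω (hopRx z i)) ^ 2

/-- Single transmission per hop, hop `i` in slot `s i`: the potential relay sets, i.e. the ordered
`m`-tuples of distinct relays within the distance constraint `d_m ≤ D` all of whose `m + 1` hops
succeed. -/
def singleSets (p : Params) (X : ℕ → Ω → Plane) (U : ℕ × Node × Node → Ω → ℝ)
    (D : ℝ) (s : Fin (m + 1) → ℕ) (ω : Ω) : Set (Fin m → ℕ) :=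
  {z | Function.Injective z ∧ routeSqDist p X z ω ≤ D ∧
    ∀ i, Success p X U (s i) (hopTx z i) (hopRx z i) ω}

/-- Best-effort retransmission, hop `i` being attempted in every slot of `T i`: the potential
relay sets, i.e. those for which every hop succeeds in at least one of its attempts. -/
def retransSets (p : Params) (X : ℕ → Ω → Plane) (U : ℕ × Node × Node → Ω → ℝ)
    (T : Fin (m + 1) → Finset ℕ) (ω : Ω) : Set (Fin m → ℕ) :=
  {z | Function.Injective z ∧
    ∀ i, ∃ t ∈ T i, Success p X U t (hopTx z i) (hopRx z i) ω}

/-- At most `M` attempts in total, in the slots `0, …, M - 1`: the potential relay sets, i.e.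
those for which there are slots `t 0 < t 1 < ⋯ < t m` such that hop `i` succeeds in slot `t i`. -/
def totalSets (p : Params) (X : ℕ → Ω → Plane) (U : ℕ × Node × Node → Ω → ℝ)
    (m M : ℕ) (ω : Ω) : Set (Fin m → ℕ) :=
  {z | Function.Injective z ∧ ∃ t : Fin (m + 1) → Fin M, StrictMono t ∧
    ∀ i, Success p X U (t i) (hopTx z i) (hopRx z i) ω}

/-- Expected number of elements of a random set of relay tuples. -/
def expectedNumber [MeasurableSpace Ω] (P : Measure Ω) (S : Ω → Set (Fin m → ℕ)) : ℝ≥0∞ :=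
  ∫⁻ ω, ((S ω).encard : ℝ≥0∞) ∂P

/-- Outage probability: the probability that there is no potential relay set. -/
def outageProb [MeasurableSpace Ω] (P : Measure Ω) (S : Ω → Set (Fin m → ℕ)) : ℝ :=
  P.real {ω | S ω = ∅}

end Model

/-- `(G κ^m / (m+1)) {exp(-Λ R² / (m+1)) - exp(-Λ D) ∑_{i<m} (Λ (D - R² / (m+1)))^i / i!}`. -/
def singleMean (p : Params) (m : ℕ) (D : ℝ) : ℝ :=
  p.G * p.kappa ^ m / (m + 1) *
    (Real.exp (-(p.bigLam * p.R ^ 2 / (m + 1))) -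
      Real.exp (-(p.bigLam * D)) *
        ∑ i ∈ Finset.range m,
          1 / (i.factorial : ℝ) * (p.bigLam * (D - p.R ^ 2 / (m + 1))) ^ i)

/-- `π^m (1-γ)^m / (γ^m K^m) · G^(∑ n_i) · exp(-Λ R² / ∑ 1/n_i) / ((∏ n_i) (∑ 1/n_i))`. -/
def basicTerm (p : Params) {m : ℕ} (n : Fin (m + 1) → ℕ) : ℝ :=
  Real.pi ^ m * (1 - p.gam) ^ m / (p.gam ^ m * p.K ^ m) * p.G ^ (∑ i, n i) *
    (Real.exp (-(p.bigLam * p.R ^ 2 / ∑ i, 1 / (n i : ℝ))) /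
      ((∏ i, (n i : ℝ)) * ∑ i, 1 / (n i : ℝ)))

/-- `∑_{1 ≤ n ≤ k} (-1)^(m + 1 + ∑ n_i) (∏ (k_i choose n_i)) basicTerm n`. -/
def retransMean (p : Params) {m : ℕ} (k : Fin (m + 1) → ℕ) : ℝ :=
  ∑ n ∈ Fintype.piFinset (fun i => Finset.Icc 1 (k i)),
    (-1) ^ (m + 1 + ∑ i, n i) * (∏ i, ((k i).choose (n i) : ℝ)) * basicTerm p n

/-- The finite set of integer vectors `j ≥ k` with `∑ j_i ≤ M`. -/
def vectors {m : ℕ} (k : Fin (m + 1) → ℕ) (M : ℕ) : Finset (Fin (m + 1) → ℕ) :=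
  (Fintype.piFinset (fun i => Finset.Icc (k i) M)).filter (fun j => ∑ i, j i ≤ M)

/-- `∑_{k ≥ 1, ∑ k_i ≤ M} (-1)^(m + 1 + ∑ k_i)
(∑_{j ≥ k, ∑ j_i ≤ M} ∏ (j_i - 1 choose k_i - 1)) basicTerm k`. -/
def totalMean (p : Params) (m M : ℕ) : ℝ :=
  ∑ k ∈ vectors (fun _ : Fin (m + 1) => 1) M,
    (-1) ^ (m + 1 + ∑ i, k i) *
      (∑ j ∈ vectors k M, ∏ i, ((j i - 1).choose (k i - 1) : ℝ)) * basicTerm p k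

end Multihop

end

/-! All three schemes are instances of one model, `routeSets`: a closed, downward closed constraint
`C` on the hop lengths and a finite set `T` of admissible slot vectors. Given the relay locations, a
route succeeds with a probability that depends only on its hop lengths: it is `Φ` evaluated at the
values of `g0` if the constraint holds, and zero otherwise. `IsCompletionProb` says what `Φ` is. In
each scheme `Φ` is a polynomial.

Mean. By linearity and Campbell's formula, the mean is the integral of this probability over all
`m`-tuples of points, because the `m`-th factorial moment measure of a Poisson process is the
product of its intensities (`IsHPPP.factorialMeasure_eq`). A monomial in the `g0` values is an
exponential of a weighted sum of squared hop lengths. In `lintegral_routeEnergy` the relays are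
integrated out one at a time by completing the square: two consecutive hops merge into one whose
reciprocal weight is the sum of the two reciprocal weights, and the area growth of discs turns each
integration into a tail integral on the line. This explains the sum of `1 / n i` in the formula, and
the truncated exponential series under a distance constraint.

Outage. Harris' inequality is used twice. Given the locations, the failures of the routes are
decreasing events of independent channels, hence the conditional outage probability is at least the
product of `1 - q` over the routes, with `q` the route's success probability. To bound the mean of
this product by `exp (-∫ q)`, a bounded window is cut into small cells. Up to an event of small
probability no cell holds two relays, and then the product is bounded below by a decreasing function
of the independent occupancies of the cells. Harris' inequality and an elementary bound for `1 - x`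
give the exponential, and refining the cells gives `IsHPPP.window_bound`. Letting the window grow to
the plane gives `IsNetwork.mean_and_outage`.

What remains is to compute `Φ` for each scheme and to expand it into monomials. -/

namespace Multihop

/-! ### Positive correlation of decreasing functions of independent events. -/

section Harris

variable {Ω ι : Type*} [Fintype ι]

open scoped Classical in
/-- The set of the indices of the events that occur. -/
noncomputable def occurring (E : ι → Set Ω) (ω : Ω) : Finset ι :=
  Finset.univ.filter fun i => ω ∈ E i

theorem mem_occurring {E : ι → Set Ω} {ω : Ω} {i : ι} : i ∈ occurring E ω ↔ ω ∈ E i := by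
  simp [occurring]

open scoped Classical in
theorem occurring_eq_iInter (E : ι → Set Ω) (S : Finset ι) :
    {ω | occurring E ω = S} = ⋂ i, if i ∈ S then E i else (E i)ᶜ := by
  ext ω
  simp only [Set.mem_ofPred_eq, Finset.ext_iff, mem_occurring, Set.mem_iInter]
  refine forall_congr' fun i => ?_
  by_cases h : i ∈ S <;> simp [h]

variable [MeasurableSpace Ω]

theorem measurableSet_occurring_eq {E : ι → Set Ω} (hE : ∀ i, MeasurableSet (E i))
    (S : Finset ι) : MeasurableSet {ω | occurring E ω = S} := by
  classical
  rw [occurring_eq_iInter]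
  refine MeasurableSet.iInter fun i => ?_
  split_ifs
  exacts [hE i, (hE i).compl]

theorem measurable_comp_occurring {E : ι → Set Ω} (hE : ∀ i, MeasurableSet (E i))
    (f : Finset ι → ℝ) : Measurable fun ω => f (occurring E ω) := by
  let _ : MeasurableSpace (Finset ι) := ⊤
  have h : Measurable (occurring E) :=
    measurable_to_countable' fun S => measurableSet_occurring_eq hE S
  exact (measurable_from_top (f := f)).comp h

variable {P : Measure Ω}

open scoped Classical in
theorem measureReal_occurring_eq {E : ι → Set Ω} (hE : iIndepSet E P) (S : Finset ι) :
    P.real {ω | occurring E ω = S} = ∏ i, P.real (if i ∈ S then E i else (E i)ᶜ) := by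
  rw [occurring_eq_iInter, measureReal_def, ((iIndepSet_iff_iIndep E P).1 hE).meas_iInter,
    ENNReal.toReal_prod]
  · rfl
  · intro i
    have h : MeasurableSet[MeasurableSpace.generateFrom {E i}] (E i) :=
      MeasurableSpace.measurableSet_generateFrom rfl
    split_ifs
    exacts [h, h.compl]

variable [IsProbabilityMeasure P]

theorem integrable_comp_occurring {E : ι → Set Ω} (hE : ∀ i, MeasurableSet (E i))
    (f : Finset ι → ℝ) : Integrable (fun ω => f (occurring E ω)) P := by
  refine Integrable.of_bound (measurable_comp_occurring hE f).aestronglyMeasurable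
    (∑ S, ‖f S‖) (ae_of_all _ fun ω => ?_)
  exact Finset.single_le_sum (f := fun S => ‖f S‖) (fun S _ => norm_nonneg _)
    (Finset.mem_univ (occurring E ω))

theorem integral_comp_occurring {E : ι → Set Ω} (hE : ∀ i, MeasurableSet (E i))
    (f : Finset ι → ℝ) :
    ∫ ω, f (occurring E ω) ∂P = ∑ S, P.real {ω | occurring E ω = S} * f S := by
  classical
  have h : (fun ω => f (occurring E ω)) =
      fun ω => ∑ S, Set.indicator {ω | occurring E ω = S} (fun _ => f S) ω := by
    funext ω
    simp [Set.indicator_apply]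
  rw [h, integral_finsetSum _ fun S _ =>
    (integrable_const (f S)).indicator (measurableSet_occurring_eq hE S)]
  refine Finset.sum_congr rfl fun S _ => ?_
  rw [integral_indicator_const _ (measurableSet_occurring_eq hE S), smul_eq_mul]

/-- Harris' inequality for two decreasing functions of independent events. -/
theorem harris_two {E : ι → Set Ω} (hE : ∀ i, MeasurableSet (E i)) (hind : iIndepSet E P)
    {f g : Finset ι → ℝ} (hf0 : 0 ≤ f) (hg0 : 0 ≤ g) (hf : Antitone f) (hg : Antitone g) :
    (∫ ω, f (occurring E ω) ∂P) * ∫ ω, g (occurring E ω) ∂P ≤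
      ∫ ω, f (occurring E ω) * g (occurring E ω) ∂P := by
  classical
  have hprod := integral_comp_occurring (P := P) hE (fun S => f S * g S)
  have hone := integral_comp_occurring (P := P) hE (fun _ => (1 : ℝ))
  simp only [integral_const, probReal_univ, smul_eq_mul, mul_one] at hone
  rw [hprod, integral_comp_occurring hE f, integral_comp_occurring hE g]
  -- The FKG inequality is stated for increasing functions; the order dual turns the decreasing ones
  -- into these.
  have key := fkg (α := (Finset ι)ᵒᵈ)
    (fun S => f (OrderDual.ofDual S)) (fun S => g (OrderDual.ofDual S))
    (fun S => P.real {ω | occurring E ω = OrderDual.ofDual S})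
    (fun S => measureReal_nonneg) (fun S => hf0 _) (fun S => hg0 _)
    (fun S T h => hf h) (fun S T h => hg h) (fun S T => by
      simp only [measureReal_occurring_eq hind, ← Finset.prod_mul_distrib, ofDual_inf, ofDual_sup,
        Finset.sup_eq_union, Finset.inf_eq_inter, Finset.mem_union, Finset.mem_inter]
      -- By independence the law of the occurring set is a product, so the lattice condition is an
      -- equality, factor by factor.
      refine le_of_eq (Finset.prod_congr rfl fun i _ => ?_)
      by_cases h1 : i ∈ OrderDual.ofDual S <;> by_cases h2 : i ∈ OrderDual.ofDual T <;>
        simp [h1, h2, mul_comm])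
  have e : ∑ S : (Finset ι)ᵒᵈ, P.real {ω | occurring E ω = OrderDual.ofDual S} = 1 := hone.symm
  rw [e, one_mul] at key
  exact key

/-- Harris' inequality for finitely many decreasing functions of independent events. -/
theorem harris {κ : Type*} {E : ι → Set Ω} (hE : ∀ i, MeasurableSet (E i))
    (hind : iIndepSet E P) {f : κ → Finset ι → ℝ} (hf0 : ∀ j, 0 ≤ f j)
    (hf : ∀ j, Antitone (f j)) (J : Finset κ) :
    ∏ j ∈ J, ∫ ω, f j (occurring E ω) ∂P ≤ ∫ ω, ∏ j ∈ J, f j (occurring E ω) ∂P := by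
  classical
  induction J using Finset.induction_on with
  | empty => simp
  | insert a J ha ih =>
    simp only [Finset.prod_insert ha]
    refine (mul_le_mul_of_nonneg_left ih (integral_nonneg fun ω => hf0 a (occurring E ω))).trans ?_
    exact harris_two hE hind (f := f a) (g := fun S => ∏ j ∈ J, f j S) (hf0 a)
      (fun S => Finset.prod_nonneg fun j _ => hf0 j S) (hf a)
      (fun S T h => Finset.prod_le_prod (fun j _ => hf0 j T) fun j _ => hf j h)

end Harris

/-! ### Counting injective tuples, and the factorial moments of the Poisson law. -/

section Counting

theorem lintegral_encard {Ω ι : Type*} [MeasurableSpace Ω] [Countable ι] {P : Measure Ω}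
    {S : Ω → Set ι} (hS : ∀ z, MeasurableSet {ω | z ∈ S ω}) :
    ∫⁻ ω, ((S ω).encard : ℝ≥0∞) ∂P = ∑' z, P {ω | z ∈ S ω} := by
  have h : ∀ ω, ((S ω).encard : ℝ≥0∞) = ∑' z, Set.indicator {ω | z ∈ S ω} (fun _ => 1) ω := by
    intro ω
    rw [← ENNReal.tsum_set_one, tsum_subtype (S ω) (fun _ => (1 : ℝ≥0∞))]
    rfl
  simp_rw [h]
  rw [lintegral_tsum fun z => (measurable_const.indicator (hS z)).aemeasurable]
  exact tsum_congr fun z => by rw [lintegral_indicator_const (hS z), one_mul]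

/-- Injective maps with prescribed disjoint ranges for the fibres of `a`. -/
def injectiveEquivEmbeddings {κ ι α : Type*} (S : ι → Set α)
    (hS : Pairwise fun c d => Disjoint (S c) (S d)) (a : κ → ι) :
    ({z | Function.Injective z ∧ ∀ i, z i ∈ S (a i)} : Set (κ → α)) ≃
      ∀ c, ({i // a i = c} ↪ S c) where
  toFun z c := ⟨fun i => ⟨z.1 i, by simpa only [i.2] using z.2.2 i⟩, fun i j h =>
    Subtype.ext (z.2.1 (congrArg Subtype.val h))⟩
  invFun e := ⟨fun i => (e (a i) ⟨i, rfl⟩ : α), by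
    refine ⟨fun i j h => ?_, fun i => (e (a i) ⟨i, rfl⟩).2⟩
    by_cases hij : a i = a j
    · have h2 : ∀ c (hc : a i = c), (e (a i) ⟨i, rfl⟩ : α) = e c ⟨i, hc⟩ := by
        rintro c rfl; rfl
      have h3 := h2 (a j) hij
      have h4 : e (a j) ⟨i, hij⟩ = e (a j) ⟨j, rfl⟩ := Subtype.ext (h3.symm.trans h)
      exact congrArg Subtype.val ((e (a j)).injective h4)
    · refine absurd h (fun h => Set.disjoint_left.1 (hS hij) (e (a i) ⟨i, rfl⟩).2 ?_)
      simp only at h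
      rw [h]
      exact (e (a j) ⟨j, rfl⟩).2⟩
  left_inv z := rfl
  right_inv e := by
    funext c
    ext ⟨i, hi⟩
    subst hi
    rfl

-- Entries in different cells differ automatically, so injectivity is a condition on each fibre of
-- `a` separately; a fibre contributes the embeddings into its cell, counted by a falling factorial.
open scoped Classical in
theorem encard_injective_tuples {κ ι α : Type*} [Fintype κ] [Fintype ι] (S : ι → Set α)
    (hS : Pairwise fun c d => Disjoint (S c) (S d)) (hfin : ∀ c, (S c).Finite) (a : κ → ι) :
    {z : κ → α | Function.Injective z ∧ ∀ i, z i ∈ S (a i)}.encard =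
      ((∏ c, (S c).ncard.descFactorial (Fintype.card {i // a i = c}) : ℕ) : ℕ∞) := by
  have := fun c => (hfin c).fintype
  have e := injectiveEquivEmbeddings S hS a
  have hf : Finite ({z | Function.Injective z ∧ ∀ i, z i ∈ S (a i)} : Set (κ → α)) :=
    Finite.of_equiv _ e.symm
  rw [← Set.Finite.cast_ncard_eq (Set.toFinite _), ← Nat.card_coe_set_eq, Nat.card_congr e,
    Nat.card_eq_fintype_card, Fintype.card_pi]
  congr 1
  refine Finset.prod_congr rfl fun c _ => ?_
  rw [Fintype.card_embedding_eq, ← Nat.card_eq_fintype_card, ← Nat.card_eq_fintype_card,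
    Nat.card_coe_set_eq]

theorem tsum_descFactorial_mul_poisson {l : ℝ} (hl : 0 ≤ l) (k : ℕ) :
    ∑' j : ℕ, (j.descFactorial k : ℝ≥0∞) *
      ENNReal.ofReal (Real.exp (-l) * l ^ j / (j.factorial : ℝ)) = ENNReal.ofReal l ^ k := by
  have hterm : ∀ j : ℕ, (j.descFactorial k : ℝ≥0∞) *
      ENNReal.ofReal (Real.exp (-l) * l ^ j / (j.factorial : ℝ)) =
      ENNReal.ofReal ((j.descFactorial k : ℝ) * (Real.exp (-l) * l ^ j / (j.factorial : ℝ))) := by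
    intro j
    rw [ENNReal.ofReal_mul (by positivity), ENNReal.ofReal_natCast]
  have hs : HasSum (fun j : ℕ => (j.descFactorial k : ℝ) *
      (Real.exp (-l) * l ^ j / (j.factorial : ℝ))) (l ^ k) := by
    have h0 : HasSum (fun j : ℕ => l ^ j / (j.factorial : ℝ)) (Real.exp l) := by
      rw [Real.exp_eq_exp_ℝ]
      exact NormedSpace.expSeries_div_hasSum_exp l
    have h1 := h0.mul_left (Real.exp (-l) * l ^ k)
    rw [show Real.exp (-l) * l ^ k * Real.exp l = l ^ k by
      rw [mul_right_comm, ← Real.exp_add]; simp] at h1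
    -- The falling factorial kills the terms below `k`; after the shift by `k` it cancels against
    -- `(j + k)!`, leaving the exponential series.
    rw [← hasSum_nat_add_iff' k]
    have hz : ∑ i ∈ Finset.range k, (i.descFactorial k : ℝ) *
        (Real.exp (-l) * l ^ i / (i.factorial : ℝ)) = 0 :=
      Finset.sum_eq_zero fun i hi => by
        rw [Nat.descFactorial_of_lt (Finset.mem_range.1 hi)]; simp
    rw [hz, sub_zero]
    refine h1.congr_fun ?_
    intro j
    have h2 := Nat.factorial_mul_descFactorial (Nat.le_add_left k j)
    rw [Nat.add_sub_cancel] at h2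
    have h3 : ((j + k).factorial : ℝ) = (j.factorial : ℝ) * ((j + k).descFactorial k : ℝ) := by
      exact_mod_cast h2.symm
    have h4 : ((j + k).descFactorial k : ℝ) ≠ 0 := by
      have : 0 < (j + k).descFactorial k := Nat.descFactorial_pos.2 (Nat.le_add_left k j)
      positivity
    rw [h3]
    field_simp
    ring
  simp_rw [hterm]
  rw [← ENNReal.ofReal_tsum_of_nonneg (fun j => by positivity) hs.summable, hs.tsum_eq,
    ENNReal.ofReal_pow hl]

end Counting

/-! ### Factorial moment measures of the Poisson process and Campbell's formula. -/

section Campbell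

/-- The intensity measure of a homogeneous Poisson process. -/
noncomputable abbrev intensity (ρ : ℝ) : Measure Plane := ENNReal.ofReal ρ • volume

instance (ρ : ℝ) : SigmaFinite (intensity ρ) :=
  inferInstanceAs (SigmaFinite (ρ.toNNReal • (volume : Measure Plane)))

variable {Ω : Type*} [MeasurableSpace Ω] {P : Measure Ω} {ρ : ℝ} {X : ℕ → Ω → Plane}

theorem IsHPPP.measurable_count (hX : IsHPPP P ρ X) {A : Set Plane} (hA : MeasurableSet A) :
    Measurable (count X A) := by
  refine measurable_encard.comp (measurable_set_iff.2 fun n => ?_)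
  exact measurableSet_setOfPred.1 (hX.measurable n hA)

variable [IsProbabilityMeasure P]

/-- The count takes values in `ℕ∞`, and its law is prescribed at finite values only. These masses
already sum to one, so the value `⊤` is negligible and the integral is a series. -/
theorem IsHPPP.lintegral_comp_count (hX : IsHPPP P ρ X) (hρ : 0 ≤ ρ) {A : Set Plane}
    (hA : MeasurableSet A) (hA' : volume A ≠ ∞) (f : ℕ∞ → ℝ≥0∞) :
    (∀ᵐ ω ∂P, count X A ω ≠ ⊤) ∧ ∫⁻ ω, f (count X A ω) ∂P = ∑' j : ℕ, f j * ENNReal.ofReal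
      (Real.exp (-(ρ * volume.real A)) * (ρ * volume.real A) ^ j / (j.factorial : ℝ)) := by
  have hm := hX.measurable_count hA
  have hl : 0 ≤ ρ * volume.real A := mul_nonneg hρ measureReal_nonneg
  have hsum : ∑' j : ℕ, P {ω | count X A ω = j} = 1 := by
    simp_rw [hX.count_law A hA hA']
    -- The factorial moment of order zero is the total mass.
    simpa using tsum_descFactorial_mul_poisson hl 0
  have hdisj : Pairwise (Function.onFun Disjoint fun j : ℕ => {ω | count X A ω = j}) := by
    intro i j hij
    refine Set.disjoint_left.2 fun ω h1 h2 => hij ?_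
    exact_mod_cast (show count X A ω = i from h1).symm.trans h2
  have hmeas : ∀ j : ℕ, MeasurableSet {ω | count X A ω = j} := fun j =>
    hm (measurableSet_singleton (j : ℕ∞))
  have htop : ∀ᵐ ω ∂P, count X A ω ≠ ⊤ := by
    have h1 : P (⋃ j : ℕ, {ω | count X A ω = j}) = 1 := by
      rw [measure_iUnion hdisj hmeas, hsum]
    have h2 : (⋃ j : ℕ, {ω | count X A ω = j}) = {ω | count X A ω ≠ ⊤} := by
      ext ω
      simp only [Set.mem_iUnion, Set.mem_ofPred_eq, ENat.ne_top_iff_exists]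
      exact exists_congr fun j => eq_comm
    rw [h2] at h1
    exact (prob_compl_eq_zero_iff (hm (MeasurableSet.of_discrete (s := {x | x ≠ ⊤})))).2 h1
  refine ⟨htop, ?_⟩
  have hae : (fun ω => f (count X A ω)) =ᵐ[P]
      fun ω => ∑' j : ℕ, Set.indicator {ω | count X A ω = j} (fun _ => f j) ω := by
    filter_upwards [htop] with ω hω
    obtain ⟨j, hj⟩ := ENat.ne_top_iff_exists.1 hω
    rw [tsum_eq_single j, Set.indicator_of_mem (show ω ∈ {ω | count X A ω = j} from hj.symm), hj]
    intro i hi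
    refine Set.indicator_of_notMem (fun h => hi ?_) _
    exact_mod_cast (show count X A ω = i from h).symm.trans hj.symm
  rw [lintegral_congr_ae hae,
    lintegral_tsum fun j => (measurable_const.indicator (hmeas j)).aemeasurable]
  refine tsum_congr fun j => ?_
  rw [lintegral_indicator_const (hmeas j), hX.count_law A hA hA']

theorem IsHPPP.count_ne_top (hX : IsHPPP P ρ X) (hρ : 0 ≤ ρ) {A : Set Plane}
    (hA : MeasurableSet A) (hA' : volume A ≠ ∞) : ∀ᵐ ω ∂P, count X A ω ≠ ⊤ :=
  (hX.lintegral_comp_count hρ hA hA' 0).1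

omit [IsProbabilityMeasure P] in
theorem IsHPPP.iIndepFun_count (hX : IsHPPP P ρ X) {ι : Type*} [Fintype ι] {A : ι → Set Plane}
    (hA : ∀ c, MeasurableSet (A c)) (hd : Pairwise fun c d => Disjoint (A c) (A d)) :
    iIndepFun (fun c => count X (A c)) P := by
  have e := Fintype.equivFin ι
  have h := hX.count_indep (Fintype.card ι) (A ∘ e.symm) (fun i => hA _)
    (fun i j hij => hd (e.symm.injective.ne hij))
  have h2 := h.precomp e.injective
  simpa [Function.comp_def] using h2

/-- The number of tuples is a product of falling factorials of independent Poisson counts, and the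
`k`-th factorial moment of a Poisson variable is the `k`-th power of its mean. The map `a` may
repeat cells. -/
theorem IsHPPP.lintegral_encard_tuples (hX : IsHPPP P ρ X) (hρ : 0 ≤ ρ) {m : ℕ} {ι : Type*}
    [Fintype ι] {A : ι → Set Plane} (hA : ∀ c, MeasurableSet (A c))
    (hA' : ∀ c, volume (A c) ≠ ∞) (hd : Pairwise fun c d => Disjoint (A c) (A d))
    (a : Fin m → ι) :
    ∫⁻ ω, (({z : Fin m → ℕ | Function.Injective z ∧ ∀ i, X (z i) ω ∈ A (a i)}.encard : ℕ∞) : ℝ≥0∞) ∂P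
      = ∏ i, ENNReal.ofReal (ρ * volume.real (A (a i))) := by
  classical
  let k : ι → ℕ := fun c => Fintype.card {i // a i = c}
  let g : ι → ℕ∞ → ℝ≥0∞ := fun c n => (n.toNat.descFactorial (k c) : ℝ≥0∞)
  have hae : ∀ᵐ ω ∂P, (({z : Fin m → ℕ | Function.Injective z ∧
      ∀ i, X (z i) ω ∈ A (a i)}.encard : ℕ∞) : ℝ≥0∞) = ∏ c, g c (count X (A c) ω) := by
    filter_upwards [ae_all_iff.2 fun c => hX.count_ne_top hρ (hA c) (hA' c)] with ω hω
    have h := encard_injective_tuples (fun c => {n | X n ω ∈ A c})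
      (fun c d hcd => Set.disjoint_left.2 fun n h1 h2 => Set.disjoint_left.1 (hd hcd) h1 h2)
      (fun c => Set.encard_ne_top_iff.1 (hω c)) a
    simp only [Set.mem_ofPred_eq] at h
    rw [h, ENat.toENNReal_coe, Nat.cast_prod]
    rfl
  rw [lintegral_congr_ae hae]
  have hg : ∀ c, Measurable (g c) := fun c => measurable_from_top
  have hind := (hX.iIndepFun_count hA hd).comp g hg
  rw [lintegral_prod_eq_prod_lintegral_of_indepFun Finset.univ
    (fun c ω => g c (count X (A c) ω)) hind
    (fun c => (hg c).comp (hX.measurable_count (hA c)))]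
  have hE : ∀ c, ∫⁻ ω, g c (count X (A c) ω) ∂P =
      ENNReal.ofReal (ρ * volume.real (A c)) ^ k c := by
    intro c
    rw [(hX.lintegral_comp_count hρ (hA c) (hA' c) (g c)).2]
    exact tsum_descFactorial_mul_poisson (mul_nonneg hρ measureReal_nonneg) (k c)
  simp_rw [hE]
  -- Grouping the indices by their cell turns the product over `Fin m` into powers with exponents `k
  -- c`.
  rw [← Finset.prod_fiberwise' (s := Finset.univ) (g := a)
    (f := fun c => ENNReal.ofReal (ρ * volume.real (A c)))]
  refine Finset.prod_congr rfl fun c _ => ?_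
  rw [Finset.prod_const]
  congr 1
  exact Fintype.card_subtype _

/-- The `m`-th factorial moment measure of the points `X 0, X 1, …`. -/
noncomputable def factorialMeasure (P : Measure Ω) (X : ℕ → Ω → Plane) (m : ℕ) :
    Measure (Fin m → Plane) :=
  Measure.sum fun z : {z : Fin m → ℕ // Function.Injective z} =>
    P.map fun ω i => X (z.1 i) ω

omit [IsProbabilityMeasure P] in
theorem IsHPPP.measurable_tuple (hX : IsHPPP P ρ X) {m : ℕ} (z : Fin m → ℕ) :
    Measurable fun ω i => X (z i) ω :=
  measurable_pi_lambda _ fun i => hX.measurable (z i)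

omit [IsProbabilityMeasure P] in
theorem IsHPPP.factorialMeasure_pi (hX : IsHPPP P ρ X) {m : ℕ} {B : Fin m → Set Plane}
    (hB : ∀ i, MeasurableSet (B i)) :
    factorialMeasure P X m (Set.univ.pi B) =
      ∫⁻ ω, (({z : Fin m → ℕ | Function.Injective z ∧ ∀ i, X (z i) ω ∈ B i}.encard : ℕ∞) : ℝ≥0∞) ∂P := by
  have hm : MeasurableSet (Set.univ.pi B) := MeasurableSet.univ_pi hB
  rw [lintegral_encard]
  · rw [factorialMeasure, Measure.sum_apply _ hm]
    rw [← tsum_subtype_eq_of_support_subset (s := {z : Fin m → ℕ | Function.Injective z})]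
    · refine tsum_congr fun z => ?_
      rw [Measure.map_apply (hX.measurable_tuple _) hm]
      congr 1
      ext ω
      have : Function.Injective z.1 := z.2
      simp [this]
    · intro z hz
      by_contra hcon
      refine hz ?_
      simp only [Set.mem_ofPred_eq] at hcon
      simp [hcon]
  · intro z
    have : {ω | z ∈ {z : Fin m → ℕ | Function.Injective z ∧ ∀ i, X (z i) ω ∈ B i}} =
        {_ω | Function.Injective z} ∩ (fun ω i => X (z i) ω) ⁻¹' (Set.univ.pi B) := by
      ext ω; simp
    rw [this]
    exact (MeasurableSet.const _).inter (hX.measurable_tuple z hm)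

/-- It suffices to compare both measures on boxes with sides of finite volume. The sides may
overlap, so they are split into the atoms of the Boolean algebra they generate; the box becomes a
disjoint union of boxes with sides among disjoint cells, where `IsHPPP.lintegral_encard_tuples`
applies. -/
theorem IsHPPP.factorialMeasure_eq (hX : IsHPPP P ρ X) (hρ : 0 ≤ ρ) (m : ℕ) :
    factorialMeasure P X m = Measure.pi fun _ => intensity ρ := by
  classical
  symm
  have hσ : ∀ A : Set Plane, volume A ≠ ∞ →
      intensity ρ A = ENNReal.ofReal (ρ * volume.real A) := by
    intro A hA
    rw [ENNReal.ofReal_mul hρ, measureReal_def, ENNReal.ofReal_toReal hA]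
    rfl
  refine Measure.pi_eq_generateFrom
    (C := fun _ => {A : Set Plane | MeasurableSet A ∧ volume A ≠ ∞}) ?_ ?_ ?_ ?_
  · intro _
    refine le_antisymm (MeasurableSpace.generateFrom_le fun A hA => hA.1) fun A hA => ?_
    have h : A = ⋃ n : ℕ, A ∩ Metric.closedBall 0 (n : ℝ) := by
      rw [← Set.inter_iUnion, Metric.iUnion_closedBall_nat, Set.inter_univ]
    rw [h]
    refine MeasurableSet.iUnion fun n => MeasurableSpace.measurableSet_generateFrom
      ⟨hA.inter measurableSet_closedBall, ?_⟩
    exact ((measure_mono Set.inter_subset_right).trans_lt measure_closedBall_lt_top).ne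
  · rintro _ A hA B hB -
    exact ⟨hA.1.inter hB.1, ((measure_mono Set.inter_subset_left).trans_lt hA.2.lt_top).ne⟩
  · intro _
    refine ⟨fun n : ℕ => Metric.closedBall 0 (n : ℝ), fun n => ⟨measurableSet_closedBall,
      measure_closedBall_lt_top.ne⟩, fun n => ?_, Metric.iUnion_closedBall_nat 0⟩
    rw [hσ _ measure_closedBall_lt_top.ne]
    exact ENNReal.ofReal_lt_top
  · intro s hs
    -- An atom is indexed by the set of sides containing it. The empty index is excluded: its atom
    -- lies outside all sides and has infinite volume.
    let ι := {S : Finset (Fin m) // S.Nonempty}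
    let A : ι → Set Plane := fun S => {x | ∀ i, x ∈ s i ↔ i ∈ S.1}
    have hA : ∀ S, MeasurableSet (A S) := by
      intro S
      have : A S = ⋂ i, if i ∈ S.1 then s i else (s i)ᶜ := by
        ext x
        simp only [A, Set.mem_ofPred_eq, Set.mem_iInter]
        refine forall_congr' fun i => ?_
        by_cases h : i ∈ S.1 <;> simp [h]
      rw [this]
      refine MeasurableSet.iInter fun i => ?_
      split_ifs
      exacts [(hs i).1, (hs i).1.compl]
    have hA' : ∀ S, volume (A S) ≠ ∞ := by
      intro S
      obtain ⟨i, hi⟩ := S.2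
      exact ((measure_mono fun x hx => (hx i).2 hi).trans_lt (hs i).2.lt_top).ne
    have hd : Pairwise fun S T => Disjoint (A S) (A T) := by
      intro S T hST
      refine Set.disjoint_left.2 fun x h1 h2 => hST (Subtype.ext (Finset.ext fun i => ?_))
      exact (h1 i).symm.trans (h2 i)
    let F : Fin m → Finset ι := fun i => Finset.univ.filter fun S => i ∈ S.1
    have hsU : ∀ i, s i = ⋃ S ∈ F i, A S := by
      intro i
      ext x
      simp only [F, Finset.mem_filter, Finset.mem_univ, true_and, Set.mem_iUnion, A,
        Set.mem_ofPred_eq, exists_prop]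
      refine ⟨fun hx => ⟨⟨Finset.univ.filter fun j => x ∈ s j, i, by simpa using hx⟩, by simpa using hx,
        fun j => by simp⟩, ?_⟩
      rintro ⟨S, hS, h⟩
      exact (h i).2 hS
    have hpi : Set.univ.pi s = ⋃ a ∈ Fintype.piFinset F, Set.univ.pi fun i => A (a i) := by
      ext x
      simp only [Set.mem_univ_pi, Set.mem_iUnion, Fintype.mem_piFinset, exists_prop]
      constructor
      · intro hx
        have h : ∀ i, ∃ S ∈ F i, x i ∈ A S := fun i => by
          have := hx i
          rw [hsU i] at this
          simpa using this
        choose a ha ha' using h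
        exact ⟨a, ha, ha'⟩
      · rintro ⟨a, ha, ha'⟩ i
        rw [hsU i]
        exact Set.mem_biUnion (ha i) (ha' i)
    rw [hpi, measure_biUnion_finset]
    · have h1 : ∀ a : Fin m → ι, factorialMeasure P X m (Set.univ.pi fun i => A (a i)) =
          ∏ i, intensity ρ (A (a i)) := by
        intro a
        rw [hX.factorialMeasure_pi fun i => hA _, hX.lintegral_encard_tuples hρ hA hA' hd a]
        exact Finset.prod_congr rfl fun i _ => (hσ _ (hA' _)).symm
      simp_rw [h1]
      rw [← Finset.prod_univ_sum F fun i S => intensity ρ (A S)]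
      refine Finset.prod_congr rfl fun i _ => ?_
      conv_rhs => rw [hsU i]
      rw [measure_biUnion_finset (fun S _ T _ h => hd h) fun S _ => hA S]
    · intro a _ b _ hab
      obtain ⟨i, hi⟩ := Function.ne_iff.1 hab
      exact Set.disjoint_left.2 fun x h1 h2 =>
        Set.disjoint_left.1 (hd hi) (h1 i trivial) (h2 i trivial)
    · exact fun a _ => MeasurableSet.univ_pi fun i => hA _

/-- Campbell's formula for ordered tuples of distinct points of a Poisson process. -/
theorem IsHPPP.tsum_lintegral_tuples (hX : IsHPPP P ρ X) (hρ : 0 ≤ ρ) {m : ℕ}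
    {f : (Fin m → Plane) → ℝ≥0∞} (hf : Measurable f) :
    ∑' z : {z : Fin m → ℕ // Function.Injective z}, ∫⁻ ω, f (fun i => X (z.1 i) ω) ∂P =
      ∫⁻ x, f x ∂Measure.pi fun _ => intensity ρ := by
  rw [← hX.factorialMeasure_eq hρ m, factorialMeasure, lintegral_sum_measure]
  refine tsum_congr fun z => ?_
  rw [lintegral_map hf (hX.measurable_tuple _)]

end Campbell

/-! ### Integrating an exponential of squared hop lengths over the relay positions. -/

section Radial

/-- The sublevel set at `t` is a disc of area `π (t - a) / b` when `t ≥ a` and is empty otherwise.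
In the plane this growth is linear, so the image measure is a multiple of Lebesgue measure on a
half-line. -/
theorem map_quadratic_volume (a : ℝ) {b : ℝ} (hb : 0 < b) (c : Plane) :
    Measure.map (fun x : Plane => a + b * ‖x - c‖ ^ 2) volume =
      ENNReal.ofReal (Real.pi / b) • (volume.restrict (Set.Ioi a) : Measure ℝ) := by
  have hmeas : Measurable fun x : Plane => a + b * ‖x - c‖ ^ 2 := by fun_prop
  have hIic : ∀ t : ℝ, Measure.map (fun x : Plane => a + b * ‖x - c‖ ^ 2) volume (Set.Iic t) =
      ENNReal.ofReal (Real.pi / b * (t - a)) := by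
    intro t
    rw [Measure.map_apply hmeas measurableSet_Iic]
    rcases lt_or_ge t a with h | h
    · have : (fun x : Plane => a + b * ‖x - c‖ ^ 2) ⁻¹' Set.Iic t = ∅ := by
        ext x
        simp only [Set.mem_preimage, Set.mem_Iic, Set.mem_empty_iff_false, iff_false, not_le]
        have : 0 ≤ b * ‖x - c‖ ^ 2 := by positivity
        linarith
      rw [this, measure_empty, ENNReal.ofReal_of_nonpos]
      exact mul_nonpos_of_nonneg_of_nonpos (by positivity) (by linarith)
    · have h0 : 0 ≤ (t - a) / b := div_nonneg (by linarith) hb.le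
      have : (fun x : Plane => a + b * ‖x - c‖ ^ 2) ⁻¹' Set.Iic t =
          Metric.closedBall c (Real.sqrt ((t - a) / b)) := by
        ext x
        rw [mem_closedBall_iff_norm, Real.le_sqrt (norm_nonneg _) h0, le_div_iff₀ hb]
        simp only [Set.mem_preimage, Set.mem_Iic]
        constructor <;> intro h <;> linarith
      rw [this, EuclideanSpace.volume_closedBall_fin_two, ← ENNReal.ofReal_pow (Real.sqrt_nonneg _),
        Real.sq_sqrt h0, ← ENNReal.ofReal_mul h0]
      congr 1
      ring
  refine Measure.ext_of_generateFrom_of_iUnion (Set.range Set.Iic) (fun n : ℕ => Set.Iic (n : ℝ))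
    ((BorelSpace.measurable_eq).trans (borel_eq_generateFrom_Iic ℝ)) isPiSystem_Iic
    ?_ (fun n => ⟨_, rfl⟩) (fun n => ?_) ?_
  · refine Set.eq_univ_of_forall fun x => Set.mem_iUnion.2 ?_
    exact exists_nat_ge x
  · rw [hIic]; exact ENNReal.ofReal_ne_top
  · rintro _ ⟨t, rfl⟩
    rw [hIic, Measure.smul_apply, Measure.restrict_apply measurableSet_Iic, Set.inter_comm,
      Set.Ioi_inter_Iic, Real.volume_Ioc, smul_eq_mul, ENNReal.ofReal_mul (by positivity)]

/-- The upper tail integral of a function. -/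
noncomputable def tailIntegral (φ : ℝ → ℝ≥0∞) (a : ℝ) : ℝ≥0∞ := ∫⁻ v in Set.Ioi a, φ v

theorem measurable_tailIntegral (φ : ℝ → ℝ≥0∞) : Measurable (tailIntegral φ) :=
  Antitone.measurable fun _ _ h => lintegral_mono_set (Set.Ioi_subset_Ioi h)

theorem lintegral_quadratic {ρ : ℝ} (hρ : 0 ≤ ρ) {φ : ℝ → ℝ≥0∞} (hφ : Measurable φ) (a : ℝ)
    {b : ℝ} (hb : 0 < b) (c : Plane) :
    ∫⁻ x, φ (a + b * ‖x - c‖ ^ 2) ∂intensity ρ =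
      ENNReal.ofReal (ρ * Real.pi / b) * tailIntegral φ a := by
  have hmeas : Measurable fun x : Plane => a + b * ‖x - c‖ ^ 2 := by fun_prop
  rw [lintegral_smul_measure, ← lintegral_map hφ hmeas, map_quadratic_volume a hb c,
    lintegral_smul_measure, tailIntegral, mul_div_assoc, ENNReal.ofReal_mul hρ, smul_eq_mul,
    smul_eq_mul, mul_assoc]

/-- Completing the square about the weighted barycentre. The residual weight has reciprocal `1 / α +
1 / β`, as for resistors in series with conductances `α` and `β`. -/
theorem weighted_sq_norm_add {α β : ℝ} (h : α + β ≠ 0) (x a b : Plane) :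
    α * ‖a - x‖ ^ 2 + β * ‖x - b‖ ^ 2 =
      α * β / (α + β) * ‖a - b‖ ^ 2 +
        (α + β) * ‖x - ((α / (α + β)) • a + (β / (α + β)) • b)‖ ^ 2 := by
  simp only [EuclideanSpace.norm_sq_eq, Fin.sum_univ_two, Real.norm_eq_abs, sq_abs, PiLp.sub_apply,
    PiLp.add_apply, PiLp.smul_apply, smul_eq_mul]
  field_simp
  ring

/-- The weighted sum of the squared hop lengths of the route `a → x 0 → ⋯ → x (m - 1) → b`. -/
noncomputable def routeEnergy {m : ℕ} (w : Fin (m + 1) → ℝ) (a b : Plane) (x : Fin m → Plane) : ℝ :=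
  ∑ i, w i * ‖(Fin.cons a x : Fin (m + 1) → Plane) i - (Fin.snoc x b : Fin (m + 1) → Plane) i‖ ^ 2

theorem measurable_routeEnergy {m : ℕ} (w : Fin (m + 1) → ℝ) (a b : Plane) :
    Measurable (routeEnergy w a b) := by
  refine Finset.measurable_fun_sum _ fun i _ => ?_
  have h1 : Measurable fun x : Fin m → Plane => (Fin.cons a x : Fin (m + 1) → Plane) i := by
    induction i using Fin.cases with
    | zero => exact measurable_const
    | succ j => exact measurable_pi_apply j
  have h2 : Measurable fun x : Fin m → Plane => (Fin.snoc x b : Fin (m + 1) → Plane) i := by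
    induction i using Fin.lastCases with
    | last => simp only [Fin.snoc_last]; exact measurable_const
    | cast j => simp only [Fin.snoc_castSucc]; exact measurable_pi_apply j
  fun_prop

/-- Integrating out the relays one at a time. -/
theorem lintegral_routeEnergy {ρ : ℝ} (hρ : 0 ≤ ρ) {m : ℕ} {w : Fin (m + 1) → ℝ}
    (hw : ∀ i, 0 < w i) {φ : ℝ → ℝ≥0∞} (hφ : Measurable φ) (a b : Plane) :
    ∫⁻ x, φ (routeEnergy w a b x) ∂Measure.pi (fun _ : Fin m => intensity ρ) =
      ENNReal.ofReal ((ρ * Real.pi) ^ m / ((∏ i, w i) * ∑ i, 1 / w i)) *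
        tailIntegral^[m] φ (‖a - b‖ ^ 2 / ∑ i, 1 / w i) := by
  induction m generalizing φ with
  | zero =>
    have h0 := (hw 0).ne'
    rw [Measure.pi_of_empty, lintegral_dirac]
    simp [routeEnergy, h0, Fin.snoc]
    rw [mul_comm]
  | succ m ih =>
    -- The weights after removing the first relay: its two hops merge. The sum of reciprocals is
    -- unchanged, and the product loses a factor `w 0 + w 1`, which the integration over the removed
    -- relay restores.
    let w' : Fin (m + 1) → ℝ := Fin.cons (w 0 * w 1 / (w 0 + w 1)) fun l => w l.succ.succ
    have h0 := hw 0
    have h1 := hw 1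
    have hw' : ∀ i, 0 < w' i := by
      intro i
      induction i using Fin.cases with
      | zero => simp only [w', Fin.cons_zero]; positivity
      | succ j => simp only [w', Fin.cons_succ]; exact hw _
    have hsum : ∑ i, 1 / w' i = ∑ i, 1 / w i := by
      rw [Fin.sum_univ_succ, Fin.sum_univ_succ, Fin.sum_univ_succ (n := m)]
      simp only [w', Fin.cons_zero, Fin.cons_succ, Fin.succ_zero_eq_one]
      field_simp
      ring
    have hprod : (∏ i, w' i) * (w 0 + w 1) = ∏ i, w i := by
      rw [Fin.prod_univ_succ, Fin.prod_univ_succ, Fin.prod_univ_succ (n := m)]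
      simp only [w', Fin.cons_zero, Fin.cons_succ, Fin.succ_zero_eq_one]
      field_simp
    -- `(Fin.snoc x b) 0` is the node following `x₀`: the next relay, or `b` if none is left.
    have hE : ∀ (x₀ : Plane) (x : Fin m → Plane),
        routeEnergy w a b (Fin.cons x₀ x : Fin (m + 1) → Plane) = routeEnergy w' a b x +
          (w 0 + w 1) * ‖x₀ - ((w 0 / (w 0 + w 1)) • a +
            (w 1 / (w 0 + w 1)) • (Fin.snoc x b : Fin (m + 1) → Plane) 0)‖ ^ 2 := by
      intro x₀ x
      have hq := weighted_sq_norm_add (by positivity : w 0 + w 1 ≠ 0) x₀ a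
        ((Fin.snoc x b : Fin (m + 1) → Plane) 0)
      unfold routeEnergy
      rw [← Fin.cons_snoc_eq_snoc_cons, Fin.sum_univ_succ, Fin.sum_univ_succ,
        Fin.sum_univ_succ (n := m)]
      simp only [w', Fin.cons_zero, Fin.cons_succ]
      simp only [Fin.succ_zero_eq_one]
      linarith
    have hmp := (measurePreserving_piFinSuccAbove (fun _ : Fin (m + 1) => intensity ρ) 0).symm
    have hφE : Measurable fun x => φ (routeEnergy w a b x) := hφ.comp (measurable_routeEnergy w a b)
    -- The first relay is split off and integrated innermost, with the others fixed.
    refine (hmp.lintegral_comp hφE).symm.trans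
      ((lintegral_prod_symm' _ (hφE.comp hmp.measurable)).trans ?_)
    have hinner : ∀ x : Fin m → Plane, ∫⁻ x₀, φ (routeEnergy w a b
        ((MeasurableEquiv.piFinSuccAbove (fun _ => Plane) 0).symm (x₀, x))) ∂intensity ρ =
        ENNReal.ofReal (ρ * Real.pi / (w 0 + w 1)) * tailIntegral φ (routeEnergy w' a b x) := by
      intro x
      rw [← lintegral_quadratic hρ hφ _ (by positivity : 0 < w 0 + w 1) ((w 0 / (w 0 + w 1)) • a +
            (w 1 / (w 0 + w 1)) • (Fin.snoc x b : Fin (m + 1) → Plane) 0)]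
      refine lintegral_congr fun x₀ => ?_
      rw [← hE]
      simp [MeasurableEquiv.piFinSuccAbove_symm_apply, Fin.insertNthEquiv]
    refine (lintegral_congr hinner).trans ?_
    have hm' : Measurable fun x => tailIntegral φ (routeEnergy w' a b x) :=
      (measurable_tailIntegral φ).comp (measurable_routeEnergy w' a b)
    rw [lintegral_const_mul _ hm', ih hw' (measurable_tailIntegral φ), Function.iterate_succ_apply, hsum, ← mul_assoc,
      ← ENNReal.ofReal_mul (by positivity), ← hprod]
    congr 2
    have hp : 0 < ∏ i, w' i := Finset.prod_pos fun i _ => hw' i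
    have hs : 0 < ∑ i, 1 / w i := Finset.sum_pos (fun i _ => one_div_pos.2 (hw i)) ⟨0, Finset.mem_univ _⟩
    field_simp
    ring

end Radial

/-! ### Iterated tail integrals of exponentials, with and without cutoff. -/

section Tails

theorem tailIntegral_iterate_exp {Λ A : ℝ} (hΛ : 0 < Λ) (hA : 0 ≤ A) (m : ℕ) (a : ℝ) :
    tailIntegral^[m] (fun v => ENNReal.ofReal (A * Real.exp (-(Λ * v)))) a =
      ENNReal.ofReal (A / Λ ^ m * Real.exp (-(Λ * a))) := by
  induction m generalizing A with
  | zero => simp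
  | succ m ih =>
    rw [Function.iterate_succ_apply]
    have h : tailIntegral (fun v => ENNReal.ofReal (A * Real.exp (-(Λ * v)))) =
        fun v => ENNReal.ofReal (A / Λ * Real.exp (-(Λ * v))) := by
      funext v
      have hI := integrableOn_exp_mul_Ioi (neg_lt_zero.2 hΛ) v
      have hv := integral_exp_mul_Ioi (neg_lt_zero.2 hΛ) v
      simp only [neg_mul] at hI hv
      rw [tailIntegral, ← ofReal_integral_eq_lintegral_ofReal (hI.const_mul A)
        (ae_of_all _ fun x => by positivity), integral_const_mul, hv]
      congr 1
      rw [neg_div_neg_eq]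
      ring
    rw [h, ih (by positivity)]
    congr 2
    field_simp
    ring

theorem hasDerivAt_expSum (m : ℕ) (x : ℝ) :
    HasDerivAt (fun x : ℝ => ∑ i ∈ Finset.range (m + 1), 1 / (i.factorial : ℝ) * x ^ i)
      (∑ i ∈ Finset.range m, 1 / (i.factorial : ℝ) * x ^ i) x := by
  have h := HasDerivAt.fun_sum (u := Finset.range (m + 1)) fun i _ =>
    (hasDerivAt_pow i x).const_mul (1 / (i.factorial : ℝ))
  refine h.congr_deriv ?_
  rw [Finset.sum_range_succ']
  simp only [Nat.cast_zero, zero_mul, mul_zero, add_zero]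
  refine Finset.sum_congr rfl fun i _ => ?_
  rw [Nat.factorial_succ, Nat.add_sub_cancel]
  push_cast
  field_simp

/-- The iterated tail integral of an exponential that is cut off at `D`. -/
noncomputable def truncatedExp (A Λ D : ℝ) (m : ℕ) (v : ℝ) : ℝ :=
  A / Λ ^ m * (Real.exp (-(Λ * v)) -
    Real.exp (-(Λ * D)) * ∑ i ∈ Finset.range m, 1 / (i.factorial : ℝ) * (Λ * (D - v)) ^ i)

/-- After factoring out `exp (-Λ D)`, this says that the exponential of a nonnegative number
dominates its Taylor polynomials. -/
theorem truncatedExp_nonneg {A Λ D : ℝ} (hA : 0 ≤ A) (hΛ : 0 < Λ) (m : ℕ) {v : ℝ} (hv : v ≤ D) :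
    0 ≤ truncatedExp A Λ D m v := by
  refine mul_nonneg (by positivity) (sub_nonneg.2 ?_)
  have h0 : 0 ≤ Λ * (D - v) := mul_nonneg hΛ.le (by linarith)
  have h := Real.sum_le_exp_of_nonneg h0 m
  have e : Real.exp (-(Λ * v)) = Real.exp (-(Λ * D)) * Real.exp (Λ * (D - v)) := by
    rw [← Real.exp_add]; congr 1; ring
  rw [e]
  refine mul_le_mul_of_nonneg_left (le_trans (le_of_eq ?_) h) (Real.exp_nonneg _)
  exact Finset.sum_congr rfl fun i _ => by ring

theorem hasDerivAt_truncatedExp {A Λ D : ℝ} (hΛ : 0 < Λ) (m : ℕ) (v : ℝ) :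
    HasDerivAt (truncatedExp A Λ D (m + 1)) (-truncatedExp A Λ D m v) v := by
  have h1 : HasDerivAt (fun v : ℝ => Λ * (D - v)) (-Λ) v := by
    simpa using ((hasDerivAt_id v).const_sub D).const_mul Λ
  have h2 : HasDerivAt (fun v : ℝ => Real.exp (-(Λ * v))) (Real.exp (-(Λ * v)) * -Λ) v := by
    have := ((hasDerivAt_id v).const_mul Λ).neg.exp
    simpa using this
  have h3 := (hasDerivAt_expSum m (Λ * (D - v))).comp v h1
  have h4 := (h2.sub (h3.const_mul (Real.exp (-(Λ * D))))).const_mul (A / Λ ^ (m + 1))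
  refine h4.congr_deriv ?_
  unfold truncatedExp
  field_simp
  ring

theorem truncatedExp_succ_self (A Λ D : ℝ) (m : ℕ) : truncatedExp A Λ D (m + 1) D = 0 := by
  simp [truncatedExp, Finset.sum_range_succ']

/-- Below the cutoff, level `m + 1` has derivative minus level `m` and vanishes at `D`, so it is the
tail integral of level `m`; above the cutoff everything vanishes. -/
theorem tailIntegral_iterate_truncated {Λ A : ℝ} (D : ℝ) (hΛ : 0 < Λ) (hA : 0 ≤ A) (m : ℕ) :
    tailIntegral^[m] ((Set.Iic D).indicator
        fun v => ENNReal.ofReal (A * Real.exp (-(Λ * v)))) =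
      (Set.Iic D).indicator fun v => ENNReal.ofReal (truncatedExp A Λ D m v) := by
  induction m with
  | zero => simp [truncatedExp]
  | succ m ih =>
    rw [Function.iterate_succ_apply', ih]
    funext a
    rw [tailIntegral, lintegral_indicator measurableSet_Iic, Measure.restrict_restrict measurableSet_Iic,
      Set.inter_comm, Set.Ioi_inter_Iic]
    by_cases ha : a ≤ D
    · rw [Set.indicator_of_mem (Set.mem_Iic.2 ha)]
      have hc : Continuous (truncatedExp A Λ D m) := by unfold truncatedExp; fun_prop
      rw [← ofReal_integral_eq_lintegral_ofReal (hc.integrableOn_Ioc)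
        ((ae_restrict_iff' measurableSet_Ioc).2
          (ae_of_all _ fun v hv => truncatedExp_nonneg hA hΛ m hv.2)),
        ← intervalIntegral.integral_of_le ha]
      congr 1
      have hd : ∀ v ∈ Set.uIcc a D, HasDerivAt (fun v => -truncatedExp A Λ D (m + 1) v)
          (truncatedExp A Λ D m v) v := fun v _ =>
        (hasDerivAt_truncatedExp hΛ m v).neg.congr_deriv (neg_neg _)
      rw [intervalIntegral.integral_eq_sub_of_hasDerivAt hd (hc.intervalIntegrable _ _),
        truncatedExp_succ_self]
      ring
    · rw [Set.indicator_of_notMem (by simpa using ha), Set.Ioc_eq_empty (by simpa using (not_le.1 ha).le)]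
      simp

end Tails

/-! ### Cutting a bounded window into small cells. -/

section Partition

/-- A bounded set is partitioned into finitely many small measurable pieces. -/
theorem exists_small_partition {W : Set Plane} (hW : Bornology.IsBounded W)
    (hWm : MeasurableSet W) {ε : ℝ} (hε : 0 < ε) :
    ∃ (N : ℕ) (A : Fin N → Set Plane) (c : Fin N → Plane), (∀ i, MeasurableSet (A i)) ∧
      (Pairwise fun i j => Disjoint (A i) (A j)) ∧ (⋃ i, A i) = W ∧
      ∀ i, A i ⊆ Metric.closedBall (c i) ε := by
  obtain ⟨t, htf, ht⟩ := Metric.totallyBounded_iff.1 (hW.isCompact_closure.totallyBounded.subset subset_closure) ε hε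
  obtain ⟨N, c, hc⟩ : ∃ (N : ℕ) (c : Fin N → Plane), Set.range c = t :=
    ⟨htf.toFinset.card, fun i => (htf.toFinset.equivFin.symm i : Plane), by
      ext x
      constructor
      · rintro ⟨i, rfl⟩
        exact htf.mem_toFinset.1 (htf.toFinset.equivFin.symm i).2
      · intro hx
        exact ⟨htf.toFinset.equivFin ⟨x, htf.mem_toFinset.2 hx⟩, by simp⟩⟩
  let B : Fin N → Set Plane := fun i => W ∩ Metric.ball (c i) ε
  have hB : ∀ i, MeasurableSet (B i) := fun i => hWm.inter measurableSet_ball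
  refine ⟨N, disjointed B, c, fun i => ?_, ?_, ?_, fun i => ?_⟩
  · exact disjointedRec (fun _ _ h => h.diff (hB _)) (hB i)
  · exact disjoint_disjointed B
  · rw [iUnion_disjointed, ← Set.inter_iUnion, Set.inter_eq_left]
    intro x hx
    obtain ⟨y, hy, hxy⟩ := Set.mem_iUnion₂.1 (ht hx)
    rw [← hc] at hy
    obtain ⟨i, rfl⟩ := hy
    exact Set.mem_iUnion.2 ⟨i, hxy⟩
  · exact ((disjointed_le B i).trans Set.inter_subset_right).trans Metric.ball_subset_closedBall

end Partition

/-! ### The exponential bound for a fixed partition into cells. -/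

section Occupancy

variable {Ω : Type*} [MeasurableSpace Ω] {P : Measure Ω} [IsProbabilityMeasure P] {ρ : ℝ}
  {X : ℕ → Ω → Plane}

omit [IsProbabilityMeasure P] in
theorem IsHPPP.measureReal_count_eq (hX : IsHPPP P ρ X) (hρ : 0 ≤ ρ) {A : Set Plane}
    (hA : MeasurableSet A) (hA' : volume A ≠ ∞) (j : ℕ) :
    P.real {ω | count X A ω = j} =
      Real.exp (-(ρ * volume.real A)) * (ρ * volume.real A) ^ j / (j.factorial : ℝ) := by
  have hl : 0 ≤ ρ * volume.real A := mul_nonneg hρ measureReal_nonneg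
  rw [measureReal_def, hX.count_law A hA hA', ENNReal.toReal_ofReal (by positivity)]

theorem IsHPPP.measureReal_one_le_count (hX : IsHPPP P ρ X) (hρ : 0 ≤ ρ) {A : Set Plane}
    (hA : MeasurableSet A) (hA' : volume A ≠ ∞) :
    P.real {ω | 1 ≤ count X A ω} ≤ ρ * volume.real A := by
  have hm : MeasurableSet {ω | count X A ω = (0 : ℕ)} :=
    hX.measurable_count hA (measurableSet_singleton _)
  have h : {ω | 1 ≤ count X A ω} = {ω | count X A ω = (0 : ℕ)}ᶜ := by
    ext ω
    simp [Order.one_le_iff_ne_zero]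
  rw [h, probReal_compl_eq_one_sub hm, hX.measureReal_count_eq hρ hA hA']
  have := Real.add_one_le_exp (-(ρ * volume.real A))
  simp
  linarith

/-- With mean `x`, the probability is `1 - exp (-x) (1 + x) ≤ 1 - (1 - x) (1 + x)`. Being quadratic,
the bound has a small sum over a fine partition. -/
theorem IsHPPP.measureReal_two_le_count (hX : IsHPPP P ρ X) (hρ : 0 ≤ ρ) {A : Set Plane}
    (hA : MeasurableSet A) (hA' : volume A ≠ ∞) :
    P.real {ω | 2 ≤ count X A ω} ≤ (ρ * volume.real A) ^ 2 := by
  have hm : ∀ j : ℕ, MeasurableSet {ω | count X A ω = j} := fun j =>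
    hX.measurable_count hA (measurableSet_singleton _)
  have h : {ω | 2 ≤ count X A ω} =
      ({ω | count X A ω = (0 : ℕ)} ∪ {ω | count X A ω = (1 : ℕ)})ᶜ := by
    ext ω
    simp only [Set.mem_ofPred_eq, Set.mem_compl_iff, Set.mem_union]
    induction count X A ω using ENat.recTopCoe with
    | top => simp
    | coe n =>
      norm_cast
      omega
  have hd : Disjoint {ω | count X A ω = (0 : ℕ)} {ω | count X A ω = (1 : ℕ)} := by
    refine Set.disjoint_left.2 fun ω h0 h1 => ?_
    have := (show count X A ω = (0 : ℕ) from h0).symm.trans h1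
    norm_num at this
  rw [h, probReal_compl_eq_one_sub ((hm 0).union (hm 1)), measureReal_union hd (hm 1),
    hX.measureReal_count_eq hρ hA hA', hX.measureReal_count_eq hρ hA hA']
  have h1 := Real.add_one_le_exp (-(ρ * volume.real A))
  have hl : 0 ≤ ρ * volume.real A := mul_nonneg hρ measureReal_nonneg
  simp
  nlinarith [Real.exp_pos (-(ρ * volume.real A))]

omit [IsProbabilityMeasure P] in
theorem IsHPPP.iIndepSet_occupied (hX : IsHPPP P ρ X) {ι : Type*} [Fintype ι]
    {A : ι → Set Plane} (hA : ∀ c, MeasurableSet (A c))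
    (hd : Pairwise fun c d => Disjoint (A c) (A d)) :
    iIndepSet (fun c => {ω | 1 ≤ count X (A c) ω}) P := by
  have hm : ∀ c, MeasurableSet {ω | 1 ≤ count X (A c) ω} := fun c =>
    hX.measurable_count (hA c) (MeasurableSet.of_discrete (s := {x | 1 ≤ x}))
  rw [iIndepSet_iff_meas_biInter hm]
  intro s
  exact (hX.iIndepFun_count hA hd).meas_biInter fun i _ =>
    ⟨{x | 1 ≤ x}, MeasurableSet.of_discrete, rfl⟩

/-- Taking reciprocals, `1 / (1 - x) = 1 + x / (1 - x) ≤ 1 + x / (1 - η)`. This converts products of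
`1 - x` into an exponential, with a loss in the exponent that disappears as `η` tends to zero. -/
theorem exp_neg_div_le_one_sub {x η : ℝ} (hx : x ≤ η) (h0 : 0 ≤ x) (hη : η < 1) :
    Real.exp (-(x / (1 - η))) ≤ 1 - x := by
  have h1 : 0 < 1 - η := by linarith
  have h2 : 0 < 1 - x := by linarith
  rw [Real.exp_neg, inv_le_comm₀ (Real.exp_pos _) h2]
  refine le_trans ?_ (Real.add_one_le_exp _)
  rw [inv_le_iff_one_le_mul₀ h2, div_add_one h1.ne', div_mul_eq_mul_div, le_div_iff₀ h1]
  nlinarith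

omit [MeasurableSpace Ω] in
/-- When no cell holds two points, the product over the tuples of points in the window is bounded
below by the product over the tuples of occupied cells. -/
theorem prod_occupied_le {m : ℕ} {ι : Type*} [Fintype ι] {A : ι → Set Plane}
    (hd : Pairwise fun c d => Disjoint (A c) (A d)) {ω : Ω}
    (h1 : ∀ c, count X (A c) ω ≤ 1) {q : (Fin m → Plane) → ℝ}
    {r : (Fin m → ι) → ℝ} (hr : ∀ a y, (∀ i, y i ∈ A (a i)) → q y ≤ r a) (hr1 : ∀ a, r a ≤ 1)
    {h : ℝ} (hh : ∀ Z : Finset (Fin m → ℕ),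
      (∀ z, z ∈ Z ↔ Function.Injective z ∧ ∀ i, X (z i) ω ∈ ⋃ c, A c) →
      ∏ z ∈ Z, (1 - q fun i => X (z i) ω) ≤ h) (S : Finset ι)
    (hS : ∀ c, c ∈ S ↔ 1 ≤ count X (A c) ω) (J : Finset (Fin m → ι))
    (hJ : ∀ a, a ∈ J ↔ Function.Injective a) [∀ a : Fin m → ι, Decidable (∀ i, a i ∈ S)] :
    ∏ a ∈ J, (1 - r a * if ∀ i, a i ∈ S then 1 else 0) ≤ h := by
  classical
  -- `l c` will be the index of the point in the cell `c`; for an empty cell it is the unused value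
  -- `0`.
  have hex : ∀ c, ∃ n, c ∈ S → X n ω ∈ A c := by
    intro c
    by_cases hc : c ∈ S
    · obtain ⟨n, hn⟩ := Set.one_le_encard_iff_nonempty.1 ((hS c).1 hc)
      exact ⟨n, fun _ => hn⟩
    · exact ⟨0, fun h => absurd h hc⟩
  choose l hl using hex
  have huniq : ∀ c n n', X n ω ∈ A c → X n' ω ∈ A c → n = n' := fun c n n' hn hn' =>
    Set.encard_le_one_iff.1 (h1 c) n n' hn hn'
  have hcell : ∀ c d x, x ∈ A c → x ∈ A d → c = d := fun c d x hc hd' => by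
    by_contra hne
    exact Set.disjoint_left.1 (hd hne) hc hd'
  have hlinj : ∀ c ∈ S, ∀ d ∈ S, l c = l d → c = d := fun c hc d hd' h =>
    hcell c d _ (hl c hc) (h ▸ hl d hd')
  let J' := J.filter fun a => ∀ i, a i ∈ S
  have hmem : ∀ a, a ∈ J' ↔ Function.Injective a ∧ ∀ i, a i ∈ S := fun a => by
    simp [J', hJ]
  -- With at most one point per cell, injective tuples of occupied cells correspond bijectively to
  -- injective tuples of points in the window.
  refine le_trans ?_ (hh (J'.image fun a i => l (a i)) fun z => ?_)
  · rw [Finset.prod_image]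
    · rw [← Finset.prod_filter_mul_prod_filter_not J (fun a => ∀ i, a i ∈ S)]
      have hone : ∏ a ∈ J.filter (fun a => ¬ ∀ i, a i ∈ S),
          (1 - r a * if ∀ i, a i ∈ S then 1 else 0) = 1 :=
        Finset.prod_eq_one fun a ha => by rw [if_neg (Finset.mem_filter.1 ha).2]; simp
      rw [hone, mul_one]
      refine Finset.prod_le_prod (fun a ha => ?_) fun a ha => ?_
      · rw [if_pos ((hmem a).1 ha).2]
        linarith [hr1 a]
      · have ha' := (hmem a).1 ha
        rw [if_pos ha'.2]
        linarith [hr a (fun i => X (l (a i)) ω) fun i => hl _ (ha'.2 i)]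
    · intro a ha b hb hab
      have ha' := (hmem a).1 ha
      have hb' := (hmem b).1 hb
      exact funext fun i => hlinj _ (ha'.2 i) _ (hb'.2 i) (congrFun hab i)
  · simp only [Finset.mem_image]
    constructor
    · rintro ⟨a, ha, rfl⟩
      have ha' := (hmem a).1 ha
      exact ⟨fun i j hij => ha'.1 (hlinj _ (ha'.2 i) _ (ha'.2 j) hij),
        fun i => Set.mem_iUnion.2 ⟨a i, hl _ (ha'.2 i)⟩⟩
    · rintro ⟨hz, hzW⟩
      choose a ha using fun i => Set.mem_iUnion.1 (hzW i)
      have haS : ∀ i, a i ∈ S := fun i =>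
        (hS _).2 (Set.one_le_encard_iff_nonempty.2 ⟨z i, ha i⟩)
      have hla : ∀ i, l (a i) = z i := fun i => huniq _ _ _ (hl _ (haS i)) (ha i)
      refine ⟨a, (hmem a).2 ⟨fun i j hij => hz ?_, haS⟩, funext hla⟩
      rw [← hla i, ← hla j, hij]

/-- The lower bound given by a partition of the window into small cells. -/
theorem IsHPPP.cell_bound (hX : IsHPPP P ρ X) (hρ : 0 ≤ ρ) {m : ℕ} (hm : 1 ≤ m) {ι : Type*}
    [Fintype ι] {A : ι → Set Plane} (hA : ∀ c, MeasurableSet (A c))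
    (hA' : ∀ c, volume (A c) ≠ ∞) (hd : Pairwise fun c d => Disjoint (A c) (A d))
    {η : ℝ} (hη : η < 1) (hAη : ∀ c, ρ * volume.real (A c) ≤ η)
    {q : (Fin m → Plane) → ℝ}
    {r : (Fin m → ι) → ℝ} (hr : ∀ a y, (∀ i, y i ∈ A (a i)) → q y ≤ r a) (hr0 : ∀ a, 0 ≤ r a)
    (hr1 : ∀ a, r a ≤ 1)
    {h : Ω → ℝ} (hint : Integrable h P) (h0 : ∀ ω, 0 ≤ h ω)
    (hh : ∀ ω, ∀ Z : Finset (Fin m → ℕ),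
      (∀ z, z ∈ Z ↔ Function.Injective z ∧ ∀ i, X (z i) ω ∈ ⋃ c, A c) →
      ∏ z ∈ Z, (1 - q fun i => X (z i) ω) ≤ h ω) :
    Real.exp (-((∑ a : Fin m → ι, r a * ∏ i, (ρ * volume.real (A (a i)))) / (1 - η))) -
      ∑ c, (ρ * volume.real (A c)) ^ 2 ≤ ∫ ω, h ω ∂P := by
  classical
  let E : ι → Set Ω := fun c => {ω | 1 ≤ count X (A c) ω}
  have hE : ∀ c, MeasurableSet (E c) := fun c =>
    hX.measurable_count (hA c) (MeasurableSet.of_discrete (s := {x | 1 ≤ x}))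
  have hind : iIndepSet E P := hX.iIndepSet_occupied hA hd
  -- For an injective tuple the occupancy events of its cells are independent, so their joint
  -- probability factors.
  let J : Finset (Fin m → ι) := Finset.univ.filter Function.Injective
  let f : (Fin m → ι) → Finset ι → ℝ := fun a S => 1 - r a * if ∀ i, a i ∈ S then 1 else 0
  have hf0 : ∀ a, 0 ≤ f a := fun a S => by
    have := hr1 a
    simp only [f, Pi.zero_apply]
    split_ifs <;> linarith
  have hf1 : ∀ a S, f a S ≤ 1 := fun a S => by
    have := hr0 a
    simp only [f]
    split_ifs <;> linarith
  have hf : ∀ a, Antitone (f a) := fun a S T hST => by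
    have := hr0 a
    simp only [f]
    by_cases h1 : ∀ i, a i ∈ S
    · have h2 : ∀ i, a i ∈ T := fun i => hST (h1 i)
      rw [if_pos h1, if_pos h2]
    · rw [if_neg h1]
      split_ifs <;> linarith
  have hH := harris hE hind hf0 hf J
  -- Where some cell holds two points the pathwise comparison may fail; subtracting `1` there makes
  -- it trivial, since the product is at most one.
  let bad : Set Ω := ⋃ c, {ω | 2 ≤ count X (A c) ω}
  have hbad : MeasurableSet bad := MeasurableSet.iUnion fun c =>
    hX.measurable_count (hA c) (MeasurableSet.of_discrete (s := {x | 2 ≤ x}))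
  have hPbad : P.real bad ≤ ∑ c, (ρ * volume.real (A c)) ^ 2 :=
    (measureReal_iUnion_fintype_le _).trans
      (Finset.sum_le_sum fun c _ => hX.measureReal_two_le_count hρ (hA c) (hA' c))
  have hpt : ∀ ω, ∏ a ∈ J, f a (occurring E ω) - bad.indicator (fun _ => (1 : ℝ)) ω ≤ h ω := by
    intro ω
    by_cases hb : ω ∈ bad
    · rw [Set.indicator_of_mem hb]
      have : ∏ a ∈ J, f a (occurring E ω) ≤ 1 :=
        Finset.prod_le_one (fun a _ => hf0 a _) fun a _ => hf1 a _
      linarith [h0 ω]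
    · rw [Set.indicator_of_notMem hb, sub_zero]
      refine prod_occupied_le (X := X) hd (fun c => ?_) hr hr1 (hh ω) (occurring E ω)
        (fun c => mem_occurring) J (fun a => by simp [J])
      by_contra hc
      refine hb (Set.mem_iUnion.2 ⟨c, ?_⟩)
      have := Order.add_one_le_of_lt (not_le.1 hc)
      rwa [one_add_one_eq_two] at this
  have hintF : Integrable (fun ω => ∏ a ∈ J, f a (occurring E ω)) P :=
    integrable_comp_occurring hE fun S => ∏ a ∈ J, f a S
  have hintB : Integrable (bad.indicator fun _ => (1 : ℝ)) P :=
    (integrable_const 1).indicator hbad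
  have hI := integral_mono (hintF.sub hintB) hint hpt
  simp only [Pi.sub_apply] at hI
  rw [integral_sub hintF hintB, integral_indicator_const _ hbad, smul_eq_mul, mul_one] at hI
  have hmean : ∀ a ∈ J, ∫ ω, f a (occurring E ω) ∂P = 1 - r a * ∏ i, P.real (E (a i)) := by
    intro a ha
    have ha' : Function.Injective a := by simpa [J] using ha
    have hset : {ω | ∀ i, a i ∈ occurring E ω} = ⋂ i, E (a i) := by
      ext ω; simp [mem_occurring]
    have hms : MeasurableSet {ω | ∀ i, a i ∈ occurring E ω} := by
      rw [hset]; exact MeasurableSet.iInter fun i => hE _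
    have hfe : (fun ω => f a (occurring E ω)) = fun ω =>
        1 - r a * {ω | ∀ i, a i ∈ occurring E ω}.indicator (fun _ => (1 : ℝ)) ω := by
      funext ω
      simp only [f, Set.indicator_apply, Set.mem_ofPred_eq]
    rw [hfe, integral_sub (integrable_const _) (((integrable_const 1).indicator hms).const_mul _),
      integral_const_mul, integral_indicator_const _ hms, hset]
    have hp : P (⋂ i, E (a i)) = ∏ i, P (E (a i)) := by
      have := (hind.precomp ha').meas_biInter Finset.univ
      simpa using this
    rw [measureReal_def, hp, ENNReal.toReal_prod]
    simp [measureReal_def]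
  rw [Finset.prod_congr rfl hmean] at hH
  have hb0 : ∀ c, 0 ≤ ρ * volume.real (A c) := fun c => mul_nonneg hρ measureReal_nonneg
  let x : (Fin m → ι) → ℝ := fun a => r a * ∏ i, (ρ * volume.real (A (a i)))
  have hx0 : ∀ a, 0 ≤ x a := fun a => mul_nonneg (hr0 a) (Finset.prod_nonneg fun i _ => hb0 _)
  -- As `m ≥ 1`, one factor can be bounded by `η`; the others are at most one.
  have hxη : ∀ a, x a ≤ η := by
    intro a
    let i₀ : Fin m := ⟨0, hm⟩
    have h1 : ∏ i, (ρ * volume.real (A (a i))) ≤ ρ * volume.real (A (a i₀)) := by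
      rw [← Finset.mul_prod_erase Finset.univ _ (Finset.mem_univ i₀)]
      refine mul_le_of_le_one_right (hb0 _) (Finset.prod_le_one (fun i _ => hb0 _) fun i _ => ?_)
      exact (hAη _).trans hη.le
    exact (mul_le_of_le_one_left (Finset.prod_nonneg fun i _ => hb0 _) (hr1 a)).trans
      (h1.trans (hAη _))
  have hlow : Real.exp (-((∑ a, x a) / (1 - η))) ≤
      ∏ a ∈ J, (1 - r a * ∏ i, P.real (E (a i))) := by
    have h1 : ∏ a ∈ J, Real.exp (-(x a / (1 - η))) ≤
        ∏ a ∈ J, (1 - r a * ∏ i, P.real (E (a i))) := by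
      refine Finset.prod_le_prod (fun a _ => (Real.exp_pos _).le) fun a _ => ?_
      refine (exp_neg_div_le_one_sub (hxη a) (hx0 a) hη).trans (sub_le_sub_left ?_ _)
      refine mul_le_mul_of_nonneg_left (Finset.prod_le_prod (fun i _ => measureReal_nonneg)
        fun i _ => ?_) (hr0 a)
      exact hX.measureReal_one_le_count hρ (hA _) (hA' _)
    refine le_trans ?_ h1
    rw [← Real.exp_sum, Finset.sum_neg_distrib, ← Finset.sum_div]
    refine Real.exp_le_exp.2 (neg_le_neg (div_le_div_of_nonneg_right ?_ (by linarith)))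
    -- Adding the non-injective tuples only lowers the exponential, and makes the sum comparable
    -- with an integral over the whole box.
    exact Finset.sum_le_univ_sum_of_nonneg hx0
  linarith

end Occupancy

/-! ### Refining the cells: the exponential bound for a bounded window. -/

section Window

open Filter Topology

variable {Ω : Type*} [MeasurableSpace Ω] {P : Measure Ω} [IsProbabilityMeasure P] {ρ : ℝ}
  {X : ℕ → Ω → Plane}

theorem intensity_real (hρ : 0 ≤ ρ) (A : Set Plane) :
    (intensity ρ).real A = ρ * volume.real A := by
  rw [measureReal_def, Measure.smul_apply, smul_eq_mul, ENNReal.toReal_mul,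
    ENNReal.toReal_ofReal hρ, measureReal_def]

theorem pi_intensity_real (hρ : 0 ≤ ρ) {m : ℕ} (A : Fin m → Set Plane) :
    (Measure.pi fun _ : Fin m => intensity ρ).real (Set.univ.pi A) =
      ∏ i, (ρ * volume.real (A i)) := by
  rw [measureReal_def, Measure.pi_pi, ENNReal.toReal_prod]
  exact Finset.prod_congr rfl fun i _ => intensity_real hρ (A i)

theorem pi_intensity_ne_top {m : ℕ} {A : Fin m → Set Plane} (hA : ∀ i, volume (A i) ≠ ∞) :
    (Measure.pi fun _ : Fin m => intensity ρ) (Set.univ.pi A) ≠ ∞ := by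
  rw [Measure.pi_pi]
  exact ENNReal.prod_ne_top fun i _ => ENNReal.mul_ne_top ENNReal.ofReal_ne_top (hA i)

/-- A sum over cells is at most the integral of a function that dominates it on every cell. -/
theorem sum_cells_le_integral (hρ : 0 ≤ ρ) {m : ℕ} {ι : Type*} [Fintype ι]
    {A : ι → Set Plane} (hA : ∀ c, MeasurableSet (A c)) (hA' : ∀ c, volume (A c) ≠ ∞)
    (hd : Pairwise fun c d => Disjoint (A c) (A d)) {r : (Fin m → ι) → ℝ}
    {f : (Fin m → Plane) → ℝ} (hf : Measurable f) {C : ℝ} (hfC : ∀ y, ‖f y‖ ≤ C)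
    (hrf : ∀ a y, (∀ i, y i ∈ A (a i)) → r a ≤ f y) :
    ∑ a : Fin m → ι, r a * ∏ i, (ρ * volume.real (A (a i))) ≤
      ∫ y in Set.univ.pi fun _ => ⋃ c, A c, f y ∂Measure.pi fun _ => intensity ρ := by
  have hU : (Set.univ.pi fun _ : Fin m => ⋃ c, A c) =
      ⋃ a : Fin m → ι, Set.univ.pi fun i => A (a i) := by
    ext y
    simp only [Set.mem_univ_pi, Set.mem_iUnion]
    exact ⟨fun h => ⟨fun i => (h i).choose, fun i => (h i).choose_spec⟩,
      fun ⟨a, ha⟩ i => ⟨a i, ha i⟩⟩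
  have hm : ∀ a : Fin m → ι, MeasurableSet (Set.univ.pi fun i => A (a i)) := fun a =>
    MeasurableSet.univ_pi fun i => hA _
  have hint : ∀ a : Fin m → ι, IntegrableOn f (Set.univ.pi fun i => A (a i))
      (Measure.pi fun _ => intensity ρ) := fun a =>
    Measure.integrableOn_of_bounded (pi_intensity_ne_top fun i => hA' _)
      hf.aestronglyMeasurable (ae_of_all _ hfC)
  rw [hU, integral_iUnion_fintype hm ?_ hint]
  · refine Finset.sum_le_sum fun a _ => ?_
    rw [← pi_intensity_real hρ, mul_comm, ← smul_eq_mul, ← setIntegral_const]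
    refine setIntegral_mono_on ?_ (hint a) (hm a) fun y hy => hrf a y fun i => hy i trivial
    exact integrableOn_const (pi_intensity_ne_top fun i => hA' _)
  · intro a b hab
    obtain ⟨i, hi⟩ := Function.ne_iff.1 hab
    exact Set.disjoint_left.2 fun x h1 h2 =>
      Set.disjoint_left.1 (hd hi) (h1 i trivial) (h2 i trivial)

/-- For a Poisson process, a functional that dominates the product of `1 - Q 0` over the ordered
tuples of distinct points in a window has expectation at least `exp (-∫ Q 0)`. -/
theorem IsHPPP.window_bound (hX : IsHPPP P ρ X) (hρ : 0 ≤ ρ) {m : ℕ} (hm : 1 ≤ m)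
    {W : Set Plane} (hW : Bornology.IsBounded W) (hWm : MeasurableSet W)
    {Q : ℝ → (Fin m → Plane) → ℝ} (hQm : ∀ δ, Measurable (Q δ)) (hQ0 : ∀ δ y, 0 ≤ Q δ y)
    (hQ1 : ∀ δ y, Q δ y ≤ 1)
    (hmono : ∀ δ ε y y', (∀ i, dist (y i) (y' i) ≤ ε) → Q δ y ≤ Q (δ + 2 * ε) y')
    (hlim : ∀ y, Tendsto (fun δ => Q δ y) (𝓝[>] 0) (𝓝 (Q 0 y)))
    {h : Ω → ℝ} (hint : Integrable h P) (h0 : ∀ ω, 0 ≤ h ω)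
    (hh : ∀ ω, ∀ Z : Finset (Fin m → ℕ),
      (∀ z, z ∈ Z ↔ Function.Injective z ∧ ∀ i, X (z i) ω ∈ W) →
      ∏ z ∈ Z, (1 - Q 0 fun i => X (z i) ω) ≤ h ω) :
    Real.exp (-∫ y in Set.univ.pi fun _ => W, Q 0 y ∂Measure.pi fun _ => intensity ρ) ≤
      ∫ ω, h ω ∂P := by
  have hWfin : volume W ≠ ∞ := hW.measure_lt_top.ne
  have hball : ∀ ε : ℝ, ∀ c : Plane, 0 ≤ ε →
      volume.real (Metric.closedBall c ε) = ε ^ 2 * Real.pi := by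
    intro ε c hε
    rw [measureReal_def, EuclideanSpace.volume_closedBall_fin_two, ENNReal.toReal_mul,
      ENNReal.toReal_pow, ENNReal.toReal_ofReal hε, ENNReal.toReal_ofReal Real.pi_pos.le]
  let I : ℝ → ℝ := fun δ => ∫ y in Set.univ.pi fun _ => W, Q δ y ∂Measure.pi fun _ => intensity ρ
  have hstep : ∀ ε : ℝ, 0 < ε → ρ * (ε ^ 2 * Real.pi) < 1 →
      Real.exp (-(I (4 * ε) / (1 - ρ * (ε ^ 2 * Real.pi)))) -
        ρ * (ε ^ 2 * Real.pi) * (ρ * volume.real W) ≤ ∫ ω, h ω ∂P := by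
    intro ε hε hη
    obtain ⟨N, A, c, hA, hd, hU, hAc⟩ := exists_small_partition hW hWm hε
    have hA' : ∀ i, volume (A i) ≠ ∞ := fun i =>
      ((measure_mono (hAc i)).trans_lt measure_closedBall_lt_top).ne
    have hAη : ∀ i, ρ * volume.real (A i) ≤ ρ * (ε ^ 2 * Real.pi) := fun i => by
      rw [← hball ε (c i) hε.le]
      exact mul_le_mul_of_nonneg_left
        (measureReal_mono (hAc i) measure_closedBall_lt_top.ne) hρ
    have hb0 : ∀ i, 0 ≤ ρ * volume.real (A i) := fun i => mul_nonneg hρ measureReal_nonneg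
    -- The cell value is `Q (2 ε)` at the centres. Each point of a cell is within `ε` of its centre,
    -- so this value dominates `Q 0` on the cell and is dominated there by `Q (4 ε)`.
    have hcell := hX.cell_bound hρ hm hA hA' hd hη hAη (q := Q 0)
      (r := fun a => Q (0 + 2 * ε) fun i => c (a i))
      (fun a y hy => hmono 0 ε _ _ fun i => Metric.mem_closedBall.1 (hAc _ (hy i)))
      (fun a => hQ0 _ _) (fun a => hQ1 _ _) hint h0 (by rw [hU]; exact hh)
    have hsum := sum_cells_le_integral hρ hA hA' hd (hQm (4 * ε)) (C := 1)
      (fun y => by rw [Real.norm_eq_abs, abs_of_nonneg (hQ0 _ _)]; exact hQ1 _ _)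
      (r := fun a => Q (0 + 2 * ε) fun i => c (a i)) (fun a y hy => by
        have := hmono (0 + 2 * ε) ε (fun i => c (a i)) y fun i => by
          rw [dist_comm]; exact Metric.mem_closedBall.1 (hAc _ (hy i))
        rwa [show 0 + 2 * ε + 2 * ε = 4 * ε by ring] at this)
    rw [hU] at hsum
    refine le_trans (sub_le_sub (Real.exp_le_exp.2 (neg_le_neg
      (div_le_div_of_nonneg_right hsum (by linarith)))) ?_) hcell
    have hWsum : volume.real W = ∑ i, volume.real (A i) := by
      rw [← hU, measureReal_iUnion_fintype hd hA hA']
    rw [hWsum, Finset.mul_sum, Finset.mul_sum]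
    refine Finset.sum_le_sum fun i _ => ?_
    rw [sq]
    exact mul_le_mul_of_nonneg_right (hAη i) (hb0 i)
  have hI : Tendsto I (𝓝[>] 0) (𝓝 (I 0)) := by
    have : IsFiniteMeasure ((Measure.pi fun _ : Fin m => intensity ρ).restrict
        (Set.univ.pi fun _ => W)) :=
      ⟨by rw [Measure.restrict_apply_univ]; exact (pi_intensity_ne_top fun _ => hWfin).lt_top⟩
    refine tendsto_integral_filter_of_dominated_convergence (fun _ => 1)
      (Eventually.of_forall fun δ => (hQm δ).aestronglyMeasurable)
      (Eventually.of_forall fun δ => ae_of_all _ fun y => ?_) (integrable_const _)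
      (ae_of_all _ hlim)
    rw [Real.norm_eq_abs, abs_of_nonneg (hQ0 _ _)]; exact hQ1 _ _
  have h4 : Tendsto (fun ε : ℝ => 4 * ε) (𝓝[>] 0) (𝓝[>] 0) := by
    refine tendsto_nhdsWithin_of_tendsto_nhds_of_eventually_within _ ?_ ?_
    · have : Tendsto (fun ε : ℝ => 4 * ε) (𝓝 0) (𝓝 (4 * 0)) := by
        exact (continuous_const.mul continuous_id).tendsto 0
      rw [mul_zero] at this
      exact this.mono_left nhdsWithin_le_nhds
    · filter_upwards [self_mem_nhdsWithin] with ε hε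
      exact mul_pos four_pos (Set.mem_Ioi.1 hε)
  have hη : Tendsto (fun ε : ℝ => ρ * (ε ^ 2 * Real.pi)) (𝓝[>] 0) (𝓝 0) := by
    have hc : Continuous fun ε : ℝ => ρ * (ε ^ 2 * Real.pi) := by fun_prop
    have := hc.tendsto 0
    simp only [ne_eq, OfNat.ofNat_ne_zero, not_false_eq_true, zero_pow, zero_mul, mul_zero] at this
    exact this.mono_left nhdsWithin_le_nhds
  have hT : Tendsto (fun ε : ℝ => Real.exp (-(I (4 * ε) / (1 - ρ * (ε ^ 2 * Real.pi)))) -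
      ρ * (ε ^ 2 * Real.pi) * (ρ * volume.real W)) (𝓝[>] 0)
      (𝓝 (Real.exp (-(I 0 / (1 - 0))) - 0 * (ρ * volume.real W))) := by
    refine Tendsto.sub ?_ (hη.mul_const _)
    refine (Real.continuous_exp.tendsto _).comp (Tendsto.neg ?_)
    exact (hI.comp h4).div (tendsto_const_nhds.sub hη) (by norm_num)
  rw [sub_zero, div_one, zero_mul, sub_zero] at hT
  refine le_of_tendsto hT ?_
  filter_upwards [self_mem_nhdsWithin, hη.eventually_lt_const one_pos] with ε h1 h2
  exact hstep ε h1 h2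

end Window

/-! ### Success of routes given the relay locations. -/

section Routes

open Filter Topology

variable {Ω : Type*} {m : ℕ} {p : Params}

/-- Length of hop `i` of the route through the points `y`. -/
noncomputable def hopLength (p : Params) (y : Fin m → Plane) (i : Fin (m + 1)) : ℝ :=
  dist ((Fin.cons !₂[-p.R / 2, 0] y : Fin (m + 1) → Plane) i)
    ((Fin.snoc y !₂[p.R / 2, 0] : Fin (m + 1) → Plane) i)

theorem dist_pos_hop (p : Params) (X : ℕ → Ω → Plane) (ω : Ω) (z : Fin m → ℕ) (i : Fin (m + 1)) :
    dist (pos p X ω (hopTx z i)) (pos p X ω (hopRx z i)) =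
      hopLength p (fun j => X (z j) ω) i := by
  have h1 : pos p X ω (hopTx z i) =
      (Fin.cons !₂[-p.R / 2, 0] (fun j => X (z j) ω) : Fin (m + 1) → Plane) i := by
    induction i using Fin.cases <;> rfl
  have h2 : pos p X ω (hopRx z i) =
      (Fin.snoc (fun j => X (z j) ω) !₂[p.R / 2, 0] : Fin (m + 1) → Plane) i := by
    induction i using Fin.lastCases <;> simp [hopRx, pos]
  rw [h1, h2, hopLength]

theorem hopTx_injective {z : Fin m → ℕ} (hz : Function.Injective z) :
    Function.Injective (hopTx z) := by
  intro i j
  induction i using Fin.cases with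
  | zero =>
    induction j using Fin.cases with
    | zero => simp
    | succ j => simp [hopTx]
  | succ i =>
    induction j using Fin.cases with
    | zero => simp [hopTx]
    | succ j =>
      intro h
      simp only [hopTx, Fin.cases_succ, Node.relay.injEq] at h
      rw [hz h]

theorem hopLength_nonneg (y : Fin m → Plane) (i : Fin (m + 1)) : 0 ≤ hopLength p y i := dist_nonneg

theorem continuous_hopLength (p : Params) (i : Fin (m + 1)) :
    Continuous fun y : Fin m → Plane => hopLength p y i := by
  have h1 : Continuous fun y : Fin m → Plane =>
      (Fin.cons !₂[-p.R / 2, 0] y : Fin (m + 1) → Plane) i := by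
    induction i using Fin.cases with
    | zero => exact continuous_const
    | succ j => exact continuous_apply j
  have h2 : Continuous fun y : Fin m → Plane =>
      (Fin.snoc y !₂[p.R / 2, 0] : Fin (m + 1) → Plane) i := by
    induction i using Fin.lastCases with
    | last => simp only [Fin.snoc_last]; exact continuous_const
    | cast j => simp only [Fin.snoc_castSucc]; exact continuous_apply j
  exact h1.dist h2

theorem hopLength_le_add {y y' : Fin m → Plane} {ε : ℝ} (hε : 0 ≤ ε)
    (h : ∀ i, dist (y i) (y' i) ≤ ε) (i : Fin (m + 1)) :
    hopLength p y' i ≤ hopLength p y i + 2 * ε := by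
  have h1 : dist ((Fin.cons !₂[-p.R / 2, 0] y' : Fin (m + 1) → Plane) i)
      ((Fin.cons !₂[-p.R / 2, 0] y : Fin (m + 1) → Plane) i) ≤ ε := by
    induction i using Fin.cases with
    | zero => simpa using hε
    | succ j => rw [dist_comm]; exact h j
  have h2 : dist ((Fin.snoc y !₂[p.R / 2, 0] : Fin (m + 1) → Plane) i)
      ((Fin.snoc y' !₂[p.R / 2, 0] : Fin (m + 1) → Plane) i) ≤ ε := by
    induction i using Fin.lastCases with
    | last => simpa using hε
    | cast j => simpa using h j
  have h3 := dist_triangle4 ((Fin.cons !₂[-p.R / 2, 0] y' : Fin (m + 1) → Plane) i)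
    ((Fin.cons !₂[-p.R / 2, 0] y : Fin (m + 1) → Plane) i)
    ((Fin.snoc y !₂[p.R / 2, 0] : Fin (m + 1) → Plane) i)
    ((Fin.snoc y' !₂[p.R / 2, 0] : Fin (m + 1) → Plane) i)
  unfold hopLength
  linarith

/-- The potential relay sets for a constraint `C` on the hop lengths and a finite set `T` of
admissible vectors of slots. -/
def routeSets (p : Params) (X : ℕ → Ω → Plane) (U : ℕ × Node × Node → Ω → ℝ)
    (C : Set (Fin (m + 1) → ℝ)) (T : Finset (Fin (m + 1) → ℕ)) (ω : Ω) : Set (Fin m → ℕ) :=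
  {z | Function.Injective z ∧ hopLength p (fun j => X (z j) ω) ∈ C ∧
    ∃ t ∈ T, ∀ i, Success p X U (t i) (hopTx z i) (hopRx z i) ω}

/-- The configurations of relay locations and channel states for which the relays `z` complete
the forwarding. -/
def goodConfigs (p : Params) (C : Set (Fin (m + 1) → ℝ)) (T : Finset (Fin (m + 1) → ℕ))
    (z : Fin m → ℕ) : Set ((ℕ → Plane) × (ℕ × Node × Node → ℝ)) :=
  {c | hopLength p (fun j => c.1 (z j)) ∈ C ∧
    ∃ t ∈ T, ∀ i, c.2 (t i, hopTx z i, hopRx z i) ≤ p.g0 (hopLength p (fun j => c.1 (z j)) i)}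

theorem mem_routeSets {X : ℕ → Ω → Plane} {U : ℕ × Node × Node → Ω → ℝ}
    {C : Set (Fin (m + 1) → ℝ)} {T : Finset (Fin (m + 1) → ℕ)} {z : Fin m → ℕ} {ω : Ω} :
    z ∈ routeSets p X U C T ω ↔ Function.Injective z ∧
      ((fun n => X n ω, fun q => U q ω) : (ℕ → Plane) × (ℕ × Node × Node → ℝ)) ∈
        goodConfigs p C T z := by
  simp only [routeSets, goodConfigs, Success, dist_pos_hop, Set.mem_ofPred_eq]

theorem continuous_g0 (p : Params) : Continuous p.g0 := by
  unfold Params.g0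
  fun_prop

theorem measurableSet_goodConfigs {C : Set (Fin (m + 1) → ℝ)} (hC : MeasurableSet C)
    (T : Finset (Fin (m + 1) → ℕ)) (z : Fin m → ℕ) : MeasurableSet (goodConfigs p C T z) := by
  have hl : ∀ i, Measurable fun c : (ℕ → Plane) × (ℕ × Node × Node → ℝ) =>
      hopLength p (fun j => c.1 (z j)) i := fun i =>
    (continuous_hopLength p i).measurable.comp
      (measurable_pi_lambda _ fun j => (measurable_pi_apply (z j)).comp measurable_fst)
  have hset : goodConfigs p C T z = {c | (fun i => hopLength p (fun j => c.1 (z j)) i) ∈ C} ∩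
      ⋃ t ∈ T, ⋂ i, {c | c.2 (t i, hopTx z i, hopRx z i) ≤
        p.g0 (hopLength p (fun j => c.1 (z j)) i)} := by
    ext c
    simp [goodConfigs]
  rw [hset]
  refine MeasurableSet.inter (measurable_pi_lambda _ hl hC) ?_
  refine Finset.measurableSet_biUnion _ fun t _ => MeasurableSet.iInter fun i => ?_
  exact measurableSet_le ((measurable_pi_apply _).comp measurable_snd)
    ((continuous_g0 p).measurable.comp (hl i))

/-- The success probability of a route as a function of the hop lengths, shortened by `δ`. -/
noncomputable def routeProb (p : Params) (C : Set (Fin (m + 1) → ℝ)) (Φ : (Fin (m + 1) → ℝ) → ℝ)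
    (δ : ℝ) (y : Fin m → Plane) : ℝ :=
  C.indicator (fun r => Φ fun i => p.g0 (r i)) fun i => max 0 (hopLength p y i - δ)

theorem routeProb_zero (C : Set (Fin (m + 1) → ℝ)) (Φ : (Fin (m + 1) → ℝ) → ℝ)
    (y : Fin m → Plane) : routeProb p C Φ 0 y =
      C.indicator (fun r => Φ fun i => p.g0 (r i)) (hopLength p y) := by
  unfold routeProb
  congr 1
  funext i
  rw [sub_zero, max_eq_right (hopLength_nonneg y i)]

/-- Independent hops with success probabilities `γ i` in every slot succeed along one of the slot
vectors of `T` with probability `Φ γ`. -/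
def IsCompletionProb [MeasurableSpace Ω] (P : Measure Ω) (U : ℕ × Node × Node → Ω → ℝ)
    (T : Finset (Fin (m + 1) → ℕ)) (Φ : (Fin (m + 1) → ℝ) → ℝ) : Prop :=
  ∀ hop : Fin (m + 1) → Node × Node, Function.Injective hop → ∀ γ : Fin (m + 1) → ℝ,
    (∀ i, γ i ∈ Set.Icc (0 : ℝ) 1) →
      P.real {ω | ∃ t ∈ T, ∀ i, U (t i, hop i) ω ≤ γ i} = Φ γ

variable [MeasurableSpace Ω] {P : Measure Ω} [IsProbabilityMeasure P]
  {X : ℕ → Ω → Plane} {U : ℕ × Node × Node → Ω → ℝ}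
  {C : Set (Fin (m + 1) → ℝ)} {T : Finset (Fin (m + 1) → ℕ)} {Φ : (Fin (m + 1) → ℝ) → ℝ}

-- Supplies hops to which `IsCompletionProb` applies, so that bounds and monotonicity of `Φ` can be
-- read off from probabilities.
omit [IsProbabilityMeasure P] in
theorem exists_injective_hops (m : ℕ) :
    ∃ hop : Fin (m + 1) → Node × Node, Function.Injective hop := by
  refine ⟨fun i => (hopTx (fun j : Fin m => (j : ℕ)) i, Node.source), fun i j h => ?_⟩
  exact hopTx_injective Fin.val_injective (congrArg Prod.fst h)

theorem IsCompletionProb.mem_Icc (hΦ : IsCompletionProb P U T Φ) {γ : Fin (m + 1) → ℝ}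
    (hγ : ∀ i, γ i ∈ Set.Icc (0 : ℝ) 1) : Φ γ ∈ Set.Icc (0 : ℝ) 1 := by
  obtain ⟨hop, hhop⟩ := exists_injective_hops m
  rw [← hΦ hop hhop γ hγ]
  exact ⟨measureReal_nonneg, measureReal_le_one⟩

theorem IsCompletionProb.mono (hΦ : IsCompletionProb P U T Φ) {γ γ' : Fin (m + 1) → ℝ}
    (hγ : ∀ i, γ i ∈ Set.Icc (0 : ℝ) 1) (hγ' : ∀ i, γ' i ∈ Set.Icc (0 : ℝ) 1)
    (h : ∀ i, γ i ≤ γ' i) : Φ γ ≤ Φ γ' := by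
  obtain ⟨hop, hhop⟩ := exists_injective_hops m
  rw [← hΦ hop hhop γ hγ, ← hΦ hop hhop γ' hγ']
  refine measureReal_mono ?_
  rintro ω ⟨t, ht, hω⟩
  exact ⟨t, ht, fun i => (hω i).trans (h i)⟩

/-- Admissible parameters. -/
structure Params.Valid (p : Params) : Prop where
  lam_pos : 0 < p.lam
  gam_pos : 0 < p.gam
  gam_lt_one : p.gam < 1
  G_pos : 0 < p.G
  G_le_one : p.G ≤ 1
  K_pos : 0 < p.K

omit [MeasurableSpace Ω] in
theorem Params.Valid.g0_mem_Icc (hp : p.Valid) (r : ℝ) : p.g0 r ∈ Set.Icc (0 : ℝ) 1 := by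
  have h := hp.G_pos.le
  have := hp.lam_pos
  have := hp.gam_pos
  have := hp.K_pos
  refine ⟨by unfold Params.g0; positivity, mul_le_one₀ hp.G_le_one (Real.exp_pos _).le ?_⟩
  rw [Real.exp_le_one_iff]
  have : 0 ≤ p.lam * p.gam * p.K * r ^ 2 := by positivity
  linarith

omit [MeasurableSpace Ω] in
theorem Params.Valid.g0_anti (hp : p.Valid) {r s : ℝ} (hr : 0 ≤ r) (hrs : r ≤ s) :
    p.g0 s ≤ p.g0 r := by
  have := hp.lam_pos
  have := hp.gam_pos
  have := hp.K_pos
  refine mul_le_mul_of_nonneg_left (Real.exp_le_exp.2 ?_) hp.G_pos.le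
  have h := mul_le_mul_of_nonneg_left (pow_le_pow_left₀ hr hrs 2)
    (by positivity : 0 ≤ p.lam * p.gam * p.K)
  linarith

omit [MeasurableSpace Ω] in
theorem measurable_routeProb (hC : MeasurableSet C) (hc : Continuous Φ) (δ : ℝ) :
    Measurable (routeProb p C Φ δ) := by
  have h1 : Measurable (C.indicator fun r : Fin (m + 1) → ℝ => Φ fun i => p.g0 (r i)) :=
    (hc.comp (continuous_pi fun i => (continuous_g0 p).comp (continuous_apply i))).measurable.indicator
      hC
  refine h1.comp (measurable_pi_lambda _ fun i => ?_)
  exact measurable_const.max ((continuous_hopLength p i).measurable.sub_const δ)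

theorem routeProb_mem_Icc (hp : p.Valid) (hΦ : IsCompletionProb P U T Φ) (δ : ℝ)
    (y : Fin m → Plane) : routeProb p C Φ δ y ∈ Set.Icc (0 : ℝ) 1 := by
  unfold routeProb
  by_cases h : (fun i => max 0 (hopLength p y i - δ)) ∈ C
  · rw [Set.indicator_of_mem h]
    exact hΦ.mem_Icc fun i => hp.g0_mem_Icc _
  · rw [Set.indicator_of_notMem h]
    exact ⟨le_rfl, zero_le_one⟩

/-- Both ends of a hop may move by `ε`, so its length changes by at most `2 * ε`, which the extra
shortening absorbs. Shorter hops stay in `C` and succeed more often. A relay exists as `m ≥ 1`, and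
it forces `ε ≥ 0`. -/
theorem routeProb_le (hp : p.Valid) (hm : 1 ≤ m) (hΦ : IsCompletionProb P U T Φ)
    (hC : ∀ r r' : Fin (m + 1) → ℝ, (∀ i, 0 ≤ r' i ∧ r' i ≤ r i) → r ∈ C → r' ∈ C)
    (δ ε : ℝ) (y y' : Fin m → Plane) (h : ∀ i, dist (y i) (y' i) ≤ ε) :
    routeProb p C Φ δ y ≤ routeProb p C Φ (δ + 2 * ε) y' := by
  have hε : 0 ≤ ε := dist_nonneg.trans (h ⟨0, hm⟩)
  by_cases hr : (fun i => max 0 (hopLength p y i - δ)) ∈ C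
  · have hle : ∀ i, max 0 (hopLength p y' i - (δ + 2 * ε)) ≤ max 0 (hopLength p y i - δ) :=
      fun i => max_le_max le_rfl (by linarith [hopLength_le_add (p := p) hε h i])
    have hr' := hC _ (fun i => max 0 (hopLength p y' i - (δ + 2 * ε)))
      (fun i => ⟨le_max_left _ _, hle i⟩) hr
    unfold routeProb
    rw [Set.indicator_of_mem hr, Set.indicator_of_mem hr']
    exact hΦ.mono (fun i => hp.g0_mem_Icc _) (fun i => hp.g0_mem_Icc _)
      fun i => hp.g0_anti (le_max_left _ _) (hle i)
  · have h0 : routeProb p C Φ δ y = 0 := Set.indicator_of_notMem hr _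
    rw [h0]
    exact (routeProb_mem_Icc hp hΦ _ _).1

-- The indicator of `C` causes no jump from the right: shortening hops cannot leave the downward
-- closed `C`, and since `C` is closed, a small shortening cannot enter it from outside.
omit [MeasurableSpace Ω] in
theorem tendsto_routeProb (hCc : IsClosed C)
    (hC : ∀ r r' : Fin (m + 1) → ℝ, (∀ i, 0 ≤ r' i ∧ r' i ≤ r i) → r ∈ C → r' ∈ C)
    (hc : Continuous Φ) (y : Fin m → Plane) :
    Tendsto (fun δ => routeProb p C Φ δ y) (𝓝[>] 0) (𝓝 (routeProb p C Φ 0 y)) := by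
  have hr : Tendsto (fun (δ : ℝ) (i : Fin (m + 1)) => max 0 (hopLength p y i - δ)) (𝓝[>] 0)
      (𝓝 fun i => max 0 (hopLength p y i - 0)) := by
    have : Continuous fun (δ : ℝ) (i : Fin (m + 1)) => max 0 (hopLength p y i - δ) := by fun_prop
    exact (this.tendsto 0).mono_left nhdsWithin_le_nhds
  by_cases h0 : (fun i => max 0 (hopLength p y i - 0)) ∈ C
  · have hev : ∀ᶠ δ : ℝ in 𝓝[>] 0, routeProb p C Φ δ y =
        Φ fun i => p.g0 (max 0 (hopLength p y i - δ)) := by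
      filter_upwards [self_mem_nhdsWithin] with δ hδ
      have hδ' : 0 < δ := hδ
      exact Set.indicator_of_mem (hC _ _ (fun i => ⟨le_max_left _ _,
        max_le_max le_rfl (by linarith)⟩) h0) _
    rw [tendsto_congr' hev, show routeProb p C Φ 0 y =
      Φ fun i => p.g0 (max 0 (hopLength p y i - 0)) from Set.indicator_of_mem h0 _]
    have hcc : Continuous fun r : Fin (m + 1) → ℝ => Φ fun i => p.g0 (r i) :=
      hc.comp (continuous_pi fun i => (continuous_g0 p).comp (continuous_apply i))
    exact (hcc.tendsto _).comp hr
  · have hev : ∀ᶠ δ : ℝ in 𝓝[>] 0, routeProb p C Φ δ y = 0 := by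
      filter_upwards [hr.eventually (hCc.isOpen_compl.mem_nhds h0)] with δ hδ
      exact Set.indicator_of_notMem hδ _
    rw [tendsto_congr' hev, show routeProb p C Φ 0 y = 0 from Set.indicator_of_notMem h0 _]
    exact tendsto_const_nhds

omit [IsProbabilityMeasure P] in
/-- Given the relay locations, a fixed route succeeds with probability `routeProb`. -/
theorem measureReal_goodConfigs (hp : p.Valid) (hΦ : IsCompletionProb P U T Φ) (x : ℕ → Plane)
    {z : Fin m → ℕ} (hz : Function.Injective z) :
    P.real {ω | (x, fun q => U q ω) ∈ goodConfigs p C T z} =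
      routeProb p C Φ 0 fun j => x (z j) := by
  rw [routeProb_zero]
  by_cases hr : hopLength p (fun j => x (z j)) ∈ C
  -- Distinct relays give the hops distinct transmitters, so no channel is shared within a route.
  · rw [Set.indicator_of_mem hr, ← hΦ (fun i => (hopTx z i, hopRx z i))
      (fun i j h => hopTx_injective hz (congrArg Prod.fst h)) _ fun i => hp.g0_mem_Icc _]
    congr 1
    ext ω
    simp [goodConfigs, hr]
  · rw [Set.indicator_of_notMem hr]
    simp [goodConfigs, hr]

/-- Given the relay locations, the events that given routes fail are positively correlated. -/
theorem prod_le_measureReal_forall_notMem (hp : p.Valid) (hUm : ∀ q, Measurable (U q))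
    (hU : iIndepFun U P) (hCm : MeasurableSet C)
    (hΦ : IsCompletionProb P U T Φ) (x : ℕ → Plane) (Z : Finset (Fin m → ℕ))
    (hZ : ∀ z ∈ Z, Function.Injective z) :
    ∏ z ∈ Z, (1 - routeProb p C Φ 0 fun j => x (z j)) ≤
      P.real {ω | ∀ z ∈ Z, (x, fun q => U q ω) ∉ goodConfigs p C T z} := by
  classical
  let posx : Node → Plane := pos p (fun n (x : ℕ → Plane) => x n) x
  have hposx : ∀ (z : Fin m → ℕ) i, dist (posx (hopTx z i)) (posx (hopRx z i)) =
      hopLength p (fun j => x (z j)) i := fun z i => dist_pos_hop p _ x z i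
  -- The finitely many channels that the routes of `Z` can use. Routes may share channels, so their
  -- failures are dependent.
  let I : Finset (ℕ × Node × Node) := Z.biUnion fun z => T.biUnion fun t =>
    Finset.univ.image fun i => (t i, hopTx z i, hopRx z i)
  have hI : ∀ z ∈ Z, ∀ t ∈ T, ∀ i, (t i, hopTx z i, hopRx z i) ∈ I := fun z hz t ht i =>
    Finset.mem_biUnion.2 ⟨z, hz, Finset.mem_biUnion.2 ⟨t, ht, Finset.mem_image_of_mem _
      (Finset.mem_univ i)⟩⟩
  let E : I → Set Ω := fun q => {ω | U q ω ≤ p.g0 (dist (posx q.1.2.1) (posx q.1.2.2))}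
  have hE : ∀ q, MeasurableSet (E q) := fun q => measurableSet_le (hUm q) measurable_const
  have hind : iIndepSet E P := by
    rw [iIndepSet_iff_meas_biInter hE]
    intro s
    exact (hU.precomp Subtype.val_injective).meas_biInter fun q _ =>
      ⟨Set.Iic (p.g0 (dist (posx q.1.2.1) (posx q.1.2.2))), measurableSet_Iic, rfl⟩
  -- Completion of a route as an increasing property of the set of successful channels, the form
  -- needed for `harris`.
  let A : (Fin m → ℕ) → Finset I → Prop := fun z S => hopLength p (fun j => x (z j)) ∈ C ∧
    ∃ t ∈ T, ∀ i, ∃ h : (t i, hopTx z i, hopRx z i) ∈ I, (⟨_, h⟩ : I) ∈ S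
  have hA : ∀ z ∈ Z, ∀ ω, A z (occurring E ω) ↔ (x, fun q => U q ω) ∈ goodConfigs p C T z := by
    intro z hz ω
    refine and_congr_right fun _ => exists_congr fun t => and_congr_right fun ht =>
      forall_congr' fun i => ?_
    rw [← hposx]
    constructor
    · rintro ⟨h, hS⟩
      exact (mem_occurring (E := E)).1 hS
    · intro h
      exact ⟨hI z hz t ht i, (mem_occurring (E := E)).2 h⟩
  have hmono : ∀ z (S S' : Finset I), S ⊆ S' → A z S → A z S' := by
    rintro z S S' hSS ⟨h1, t, ht, h2⟩
    exact ⟨h1, t, ht, fun i => ⟨(h2 i).1, hSS (h2 i).2⟩⟩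
  let f : (Fin m → ℕ) → Finset I → ℝ := fun z S => if A z S then 0 else 1
  have hf0 : ∀ z, 0 ≤ f z := fun z S => by
    simp only [f, Pi.zero_apply]
    split_ifs <;> norm_num
  have hf : ∀ z, Antitone (f z) := fun z S S' hSS => by
    simp only [f]
    by_cases h1 : A z S
    · rw [if_pos h1, if_pos (hmono z S S' hSS h1)]
    · rw [if_neg h1]
      split_ifs <;> norm_num
  have hg : ∀ z, MeasurableSet {ω | (x, fun q => U q ω) ∈ goodConfigs p C T z} := fun z =>
    (measurable_const.prodMk (measurable_pi_lambda _ hUm)) (measurableSet_goodConfigs hCm T z)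
  have hH := harris hE hind hf0 hf Z
  have hl : ∀ z ∈ Z, ∫ ω, f z (occurring E ω) ∂P =
      1 - routeProb p C Φ 0 fun j => x (z j) := by
    intro z hz
    have h1 : (fun ω => f z (occurring E ω)) =
        {ω | (x, fun q => U q ω) ∈ goodConfigs p C T z}ᶜ.indicator fun _ => 1 := by
      funext ω
      simp only [f, hA z hz ω, Set.indicator_apply, Set.mem_compl_iff, Set.mem_ofPred_eq]
      split_ifs <;> simp_all
    rw [h1, integral_indicator_const _ (hg z).compl, probReal_compl_eq_one_sub (hg z),
      measureReal_goodConfigs hp hΦ x (hZ z hz), smul_eq_mul, mul_one]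
  have hr : (fun ω => ∏ z ∈ Z, f z (occurring E ω)) =
      {ω | ∀ z ∈ Z, (x, fun q => U q ω) ∉ goodConfigs p C T z}.indicator fun _ => 1 := by
    funext ω
    by_cases h : ∀ z ∈ Z, (x, fun q => U q ω) ∉ goodConfigs p C T z
    · simp only [Set.indicator_apply, Set.mem_ofPred_eq, if_pos h]
      refine Finset.prod_eq_one fun z hz => if_neg ?_
      rw [hA z hz ω]
      exact h z hz
    · simp only [Set.indicator_apply, Set.mem_ofPred_eq, if_neg h]
      push Not at h
      obtain ⟨z, hz, hzg⟩ := h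
      exact Finset.prod_eq_zero hz (if_pos ((hA z hz ω).2 hzg))
  have hms : MeasurableSet {ω | ∀ z ∈ Z, (x, fun q => U q ω) ∉ goodConfigs p C T z} := by
    have : {ω | ∀ z ∈ Z, (x, fun q => U q ω) ∉ goodConfigs p C T z} =
        ⋂ z ∈ Z, {ω | (x, fun q => U q ω) ∈ goodConfigs p C T z}ᶜ := by
      ext ω; simp
    rw [this]
    exact Finset.measurableSet_biInter _ fun z _ => (hg z).compl
  rw [Finset.prod_congr rfl hl, hr, integral_indicator_const _ hms, smul_eq_mul, mul_one] at hH
  exact hH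

/-- Conditioning on the relay locations. -/
theorem IsNetwork.lintegral_section (hnet : IsNetwork p P X U)
    {B : Set ((ℕ → Plane) × (ℕ × Node × Node → ℝ))} (hB : MeasurableSet B) :
    ∫⁻ ω, P {ω' | (fun n => X n ω, fun q => U q ω') ∈ B} ∂P =
      P {ω | (fun n => X n ω, fun q => U q ω) ∈ B} := by
  have hXm : Measurable fun ω n => X n ω := measurable_pi_lambda _ hnet.relays.measurable
  have hUm : Measurable fun ω q => U q ω := measurable_pi_lambda _ hnet.channel_measurable
  have h := hnet.indep.map_prod_eq_prod_map_map hXm.aemeasurable hUm.aemeasurable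
  have h1 : P {ω | (fun n => X n ω, fun q => U q ω) ∈ B} =
      (P.map fun ω => ((fun n => X n ω : ℕ → Plane), fun q => U q ω)) B := by
    rw [Measure.map_apply (hXm.prodMk hUm) hB]
    rfl
  have : IsProbabilityMeasure (P.map fun ω q => U q ω) :=
    Measure.isProbabilityMeasure_map hUm.aemeasurable
  rw [h1, h, Measure.prod_apply hB, lintegral_map (measurable_measure_prodMk_left hB) hXm]
  refine lintegral_congr fun ω => ?_
  rw [Measure.map_apply hUm (measurable_prodMk_left hB)]
  rfl

theorem IsNetwork.measurable_section (hnet : IsNetwork p P X U)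
    {B : Set ((ℕ → Plane) × (ℕ × Node × Node → ℝ))} (hB : MeasurableSet B) :
    Measurable fun ω => P {ω' | (fun n => X n ω, fun q => U q ω') ∈ B} := by
  have hXm : Measurable fun ω n => X n ω := measurable_pi_lambda _ hnet.relays.measurable
  have hUm : Measurable fun ω q => U q ω := measurable_pi_lambda _ hnet.channel_measurable
  have h : MeasurableSet {c : Ω × Ω | ((fun n => X n c.1, fun q => U q c.2) :
      (ℕ → Plane) × (ℕ × Node × Node → ℝ)) ∈ B} :=
    ((hXm.comp measurable_fst).prodMk (hUm.comp measurable_snd)) hB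
  exact measurable_measure_prodMk_left h

end Routes

/-! ### Averaging over the relays: mean and outage for a general scheme. -/

section Network

open Filter Topology

variable {Ω : Type*} [MeasurableSpace Ω] {P : Measure Ω} [IsProbabilityMeasure P] {m : ℕ}
  {p : Params} {X : ℕ → Ω → Plane} {U : ℕ × Node × Node → Ω → ℝ}
  {C : Set (Fin (m + 1) → ℝ)} {T : Finset (Fin (m + 1) → ℕ)} {Φ : (Fin (m + 1) → ℝ) → ℝ}

omit [MeasurableSpace Ω] in
theorem Params.Valid.relayDensity_nonneg (hp : p.Valid) : 0 ≤ p.relayDensity :=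
  mul_nonneg (sub_nonneg.2 hp.gam_lt_one.le) hp.lam_pos.le

omit [IsProbabilityMeasure P] in
theorem IsNetwork.measurable_config (hnet : IsNetwork p P X U) :
    Measurable fun ω => ((fun n => X n ω, fun q => U q ω) :
      (ℕ → Plane) × (ℕ × Node × Node → ℝ)) :=
  (measurable_pi_lambda _ hnet.relays.measurable).prodMk
    (measurable_pi_lambda _ hnet.channel_measurable)

/-- Sum the success probabilities over injective tuples, condition each on the relay locations, and
apply Campbell's formula. -/
theorem IsNetwork.expectedNumber_routeSets (hnet : IsNetwork p P X U) (hp : p.Valid)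
    (hCm : MeasurableSet C) (hΦ : IsCompletionProb P U T Φ) (hc : Continuous Φ) :
    expectedNumber P (routeSets p X U C T) =
      ∫⁻ y, ENNReal.ofReal (routeProb p C Φ 0 y)
        ∂Measure.pi fun _ : Fin m => intensity p.relayDensity := by
  have hset : ∀ z, {ω | z ∈ routeSets p X U C T ω} = {_ω | Function.Injective z} ∩
      {ω | (fun n => X n ω, fun q => U q ω) ∈ goodConfigs p C T z} := fun z => by
    ext ω
    exact mem_routeSets
  have hg : ∀ z, MeasurableSet {ω | (fun n => X n ω, fun q => U q ω) ∈ goodConfigs p C T z} :=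
    fun z => hnet.measurable_config (measurableSet_goodConfigs hCm T z)
  have hQ : Measurable fun y => ENNReal.ofReal (routeProb p C Φ 0 y) :=
    (measurable_routeProb hCm hc 0).ennreal_ofReal
  rw [expectedNumber, lintegral_encard fun z => by
      rw [hset]; exact (MeasurableSet.const _).inter (hg z),
    ← hnet.relays.tsum_lintegral_tuples hp.relayDensity_nonneg hQ]
  have hsupp : Function.support (fun z => P {ω | z ∈ routeSets p X U C T ω}) ⊆
      {z : Fin m → ℕ | Function.Injective z} := by
    intro z hz
    by_contra hcon
    refine hz ?_
    have : ¬ Function.Injective z := hcon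
    simp only
    rw [hset]
    simp [this]
  rw [← tsum_subtype_eq_of_support_subset hsupp]
  refine tsum_congr fun z => ?_
  have hz : Function.Injective z.1 := z.2
  rw [hset]
  simp only [hz, Set.ofPred_true, Set.univ_inter]
  rw [← hnet.lintegral_section (measurableSet_goodConfigs hCm T z.1)]
  refine lintegral_congr fun ω => ?_
  rw [← measureReal_goodConfigs hp hΦ (fun n => X n ω) hz, measureReal_def,
    ENNReal.ofReal_toReal (measure_ne_top _ _)]

/-- The outage bound for the relay sets inside a bounded window. -/
theorem IsNetwork.window_outage (hnet : IsNetwork p P X U) (hp : p.Valid) (hm : 1 ≤ m)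
    (hCc : IsClosed C)
    (hC : ∀ r r' : Fin (m + 1) → ℝ, (∀ i, 0 ≤ r' i ∧ r' i ≤ r i) → r ∈ C → r' ∈ C)
    (hΦ : IsCompletionProb P U T Φ) (hc : Continuous Φ) {W : Set Plane}
    (hW : Bornology.IsBounded W) (hWm : MeasurableSet W) :
    Real.exp (-∫ y in Set.univ.pi fun _ => W, routeProb p C Φ 0 y
        ∂Measure.pi fun _ : Fin m => intensity p.relayDensity) ≤
      P.real {ω | ∀ z ∈ routeSets p X U C T ω, ¬ ∀ i, X (z i) ω ∈ W} := by
  let B : Set ((ℕ → Plane) × (ℕ × Node × Node → ℝ)) :=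
    ⋂ z : {z : Fin m → ℕ // Function.Injective z},
      ({c | ∀ i, c.1 (z.1 i) ∈ W} ∩ goodConfigs p C T z.1)ᶜ
  have hB : MeasurableSet B := by
    refine MeasurableSet.iInter fun z => (MeasurableSet.inter ?_
      (measurableSet_goodConfigs hCc.measurableSet T z.1)).compl
    have : {c : (ℕ → Plane) × (ℕ × Node × Node → ℝ) | ∀ i, c.1 (z.1 i) ∈ W} =
        ⋂ i, (fun c => c.1 (z.1 i)) ⁻¹' W := by
      ext c; simp
    rw [this]
    exact MeasurableSet.iInter fun i => ((measurable_pi_apply _).comp measurable_fst) hWm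
  -- The conditional probability, given the relay locations, that every route in the window fails.
  let h : Ω → ℝ := fun ω => P.real {ω' | (fun n => X n ω, fun q => U q ω') ∈ B}
  have hmeas : Measurable h := (hnet.measurable_section hB).ennreal_toReal
  have hint : Integrable h P := by
    refine Integrable.of_bound hmeas.aestronglyMeasurable 1 (ae_of_all _ fun ω => ?_)
    rw [Real.norm_eq_abs, abs_of_nonneg measureReal_nonneg]
    exact measureReal_le_one
  have hset : {ω | (fun n => X n ω, fun q => U q ω) ∈ B} =
      {ω | ∀ z ∈ routeSets p X U C T ω, ¬ ∀ i, X (z i) ω ∈ W} := by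
    ext ω
    simp only [B, Set.mem_ofPred_eq, Set.mem_iInter, Set.mem_compl_iff, Set.mem_inter_iff, not_and,
      mem_routeSets, Subtype.forall, and_imp]
    exact forall_congr' fun z => ⟨fun h1 h2 h3 h4 => h1 h2 h4 h3, fun h1 h2 h3 h4 => h1 h2 h4 h3⟩
  have hI : ∫ ω, h ω ∂P = P.real {ω | ∀ z ∈ routeSets p X U C T ω, ¬ ∀ i, X (z i) ω ∈ W} := by
    rw [← hset, measureReal_def, ← hnet.lintegral_section hB]
    exact integral_toReal (hnet.measurable_section hB).aemeasurable
      (ae_of_all _ fun ω => measure_lt_top _ _)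
  rw [← hI]
  refine hnet.relays.window_bound hp.relayDensity_nonneg hm hW hWm
    (fun δ => measurable_routeProb hCc.measurableSet hc δ)
    (fun δ y => (routeProb_mem_Icc hp hΦ δ y).1) (fun δ y => (routeProb_mem_Icc hp hΦ δ y).2)
    (routeProb_le hp hm hΦ hC) (tendsto_routeProb hCc hC hc) hint (fun ω => measureReal_nonneg)
    fun ω Z hZ => ?_
  -- `Z` lists all injective tuples in the window. If these are infinitely many, no such `Z` exists
  -- and nothing is required.
  refine (prod_le_measureReal_forall_notMem hp hnet.channel_measurable hnet.channel_indep
    hCc.measurableSet hΦ (fun n => X n ω) Z fun z hz => ((hZ z).1 hz).1).trans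
    (measureReal_mono fun ω' hω' => ?_)
  refine Set.mem_iInter.2 fun z hz => ?_
  exact hω' z.1 ((hZ z.1).2 ⟨z.2, hz.1⟩) hz.2

/-- Mean number of potential relay sets and outage bound, in terms of the integral of the success
probability of a route. -/
theorem IsNetwork.mean_and_outage (hnet : IsNetwork p P X U) (hp : p.Valid) (hm : 1 ≤ m)
    (hCc : IsClosed C)
    (hC : ∀ r r' : Fin (m + 1) → ℝ, (∀ i, 0 ≤ r' i ∧ r' i ≤ r i) → r ∈ C → r' ∈ C)
    (hΦ : IsCompletionProb P U T Φ) (hc : Continuous Φ) {μ : ℝ} (hμ : 0 ≤ μ)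
    (hint : ∫⁻ y, ENNReal.ofReal (C.indicator (fun r => Φ fun i => p.g0 (r i)) (hopLength p y))
        ∂Measure.pi (fun _ : Fin m => intensity p.relayDensity) = ENNReal.ofReal μ) :
    expectedNumber P (routeSets p X U C T) = ENNReal.ofReal μ ∧
      Real.exp (-μ) ≤ outageProb P (routeSets p X U C T) := by
  simp_rw [← routeProb_zero] at hint
  refine ⟨by rw [hnet.expectedNumber_routeSets hp hCc.measurableSet hΦ hc, hint], ?_⟩
  have hQm := measurable_routeProb (p := p) hCc.measurableSet hc 0
  have hQ0 : ∀ y, 0 ≤ routeProb p C Φ 0 y := fun y => (routeProb_mem_Icc hp hΦ 0 y).1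
  have hQi : Integrable (routeProb p C Φ 0)
      (Measure.pi fun _ : Fin m => intensity p.relayDensity) := by
    refine (lintegral_ofReal_ne_top_iff_integrable hQm.aestronglyMeasurable
      (ae_of_all _ hQ0)).1 ?_
    rw [hint]; exact ENNReal.ofReal_ne_top
  have hQ : ∫ y, routeProb p C Φ 0 y ∂(Measure.pi fun _ : Fin m => intensity p.relayDensity) = μ := by
    rw [integral_eq_lintegral_of_nonneg_ae (ae_of_all _ hQ0) hQm.aestronglyMeasurable, hint,
      ENNReal.toReal_ofReal hμ]
  -- Outage restricted to growing discs. These events decrease to the full outage event, and each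
  -- has probability at least `exp (-μ)` because the integral over a window is at most `μ`.
  let S : ℕ → Set Ω := fun n =>
    {ω | ∀ z ∈ routeSets p X U C T ω, ¬ ∀ i, X (z i) ω ∈ Metric.closedBall 0 (n : ℝ)}
  have hS : ∀ n, Real.exp (-μ) ≤ P.real (S n) := fun n => by
    refine le_trans (Real.exp_le_exp.2 (neg_le_neg ?_)) (hnet.window_outage hp hm hCc hC hΦ hc
      Metric.isBounded_closedBall measurableSet_closedBall)
    rw [← hQ]
    exact setIntegral_le_integral hQi (ae_of_all _ hQ0)
  have hanti : Antitone S := fun n k hnk ω hω z hz hzi => hω z hz fun i =>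
    Metric.closedBall_subset_closedBall (Nat.cast_le.2 hnk) (hzi i)
  have hmeas : ∀ n, MeasurableSet (S n) := by
    intro n
    have : S n = ⋂ z : Fin m → ℕ, ({_ω | Function.Injective z} ∩
        {ω | (fun n => X n ω, fun q => U q ω) ∈ goodConfigs p C T z} ∩
        ⋂ i, X (z i) ⁻¹' Metric.closedBall 0 (n : ℝ))ᶜ := by
      ext ω
      simp only [S, mem_routeSets, Set.mem_ofPred_eq, Set.mem_iInter, Set.mem_compl_iff,
        Set.mem_inter_iff, Set.mem_preimage, not_and, and_imp]
    rw [this]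
    exact MeasurableSet.iInter fun z => (((MeasurableSet.const _).inter
      (hnet.measurable_config (measurableSet_goodConfigs hCc.measurableSet T z))).inter
      (MeasurableSet.iInter fun i => hnet.relays.measurable _ measurableSet_closedBall)).compl
  have hInter : {ω | routeSets p X U C T ω = ∅} = ⋂ n, S n := by
    ext ω
    simp only [S, Set.mem_ofPred_eq, Set.mem_iInter, Set.eq_empty_iff_forall_notMem]
    refine ⟨fun h n z hz => absurd hz (h z), fun h z hz => ?_⟩
    -- This radius exceeds the norm of every relay of the tuple.
    obtain ⟨n, hn⟩ := exists_nat_ge (∑ i, ‖X (z i) ω‖)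
    refine h n z hz fun i => mem_closedBall_zero_iff.2 (le_trans ?_ hn)
    exact Finset.single_le_sum (f := fun i => ‖X (z i) ω‖) (fun _ _ => norm_nonneg _)
      (Finset.mem_univ i)
  rw [outageProb, hInter]
  have hlim := tendsto_measure_iInter_atTop (μ := P) (fun n => (hmeas n).nullMeasurableSet) hanti
    ⟨0, measure_ne_top _ _⟩
  have hlim' := (ENNReal.tendsto_toReal (measure_ne_top P (⋂ n, S n))).comp hlim
  exact ge_of_tendsto' hlim' hS

end Network

/-! ### Evaluating the integrals in closed form. -/

section Means

variable {m : ℕ} {p : Params}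

theorem Params.Valid.bigLam_pos (hp : p.Valid) : 0 < p.bigLam :=
  mul_pos (mul_pos hp.lam_pos hp.gam_pos) hp.K_pos

theorem g0_eq (p : Params) (r : ℝ) : p.g0 r = p.G * Real.exp (-(p.bigLam * r ^ 2)) := by
  unfold Params.g0 Params.bigLam
  congr 2
  ring

theorem sum_mul_hopLength_sq (p : Params) (w : Fin (m + 1) → ℝ) (y : Fin m → Plane) :
    ∑ i, w i * hopLength p y i ^ 2 =
      routeEnergy w !₂[-p.R / 2, 0] !₂[p.R / 2, 0] y := by
  simp only [hopLength, routeEnergy, dist_eq_norm]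

theorem sq_dist_source_dest (p : Params) :
    ‖(!₂[-p.R / 2, 0] : Plane) - !₂[p.R / 2, 0]‖ ^ 2 = p.R ^ 2 := by
  rw [EuclideanSpace.norm_sq_eq, Fin.sum_univ_two]
  simp
  ring

theorem prod_g0_pow (p : Params) (n : Fin (m + 1) → ℕ) (y : Fin m → Plane) :
    ∏ i, p.g0 (hopLength p y i) ^ n i = p.G ^ (∑ i, n i) * Real.exp (-(p.bigLam *
      routeEnergy (fun i => (n i : ℝ)) !₂[-p.R / 2, 0] !₂[p.R / 2, 0] y)) := by
  simp_rw [g0_eq, mul_pow, Finset.prod_mul_distrib, Finset.prod_pow_eq_pow_sum, ← Real.exp_nat_mul]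
  rw [← Real.exp_sum, ← sum_mul_hopLength_sq, Finset.mul_sum, ← Finset.sum_neg_distrib]
  congr 2
  exact Finset.sum_congr rfl fun i _ => by ring

/-- The exponents `n i` act as the weights of `routeEnergy` and must be positive. Each of the `m`
tail integrations of the exponential contributes a factor `1 / Λ`. -/
theorem Params.Valid.lintegral_monomial (hp : p.Valid) {n : Fin (m + 1) → ℕ}
    (hn : ∀ i, 1 ≤ n i) :
    ∫⁻ y, ENNReal.ofReal (∏ i, p.g0 (hopLength p y i) ^ n i)
        ∂Measure.pi (fun _ : Fin m => intensity p.relayDensity) =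
      ENNReal.ofReal (basicTerm p n) := by
  have hΛ := hp.bigLam_pos
  have hn' : ∀ i, 0 < (n i : ℝ) := fun i => Nat.cast_pos.2 (hn i)
  have hρ := hp.relayDensity_nonneg
  have hG := hp.G_pos
  have hφ : Measurable fun v : ℝ =>
      ENNReal.ofReal (p.G ^ (∑ i, n i) * Real.exp (-(p.bigLam * v))) := by fun_prop
  simp_rw [prod_g0_pow]
  rw [lintegral_routeEnergy hρ hn' hφ, tailIntegral_iterate_exp hΛ (by positivity),
    sq_dist_source_dest]
  have hS : 0 < ∑ i, 1 / (n i : ℝ) :=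
    Finset.sum_pos (fun i _ => one_div_pos.2 (hn' i)) ⟨0, Finset.mem_univ _⟩
  have hP : 0 < ∏ i, (n i : ℝ) := Finset.prod_pos fun i _ => hn' i
  rw [← ENNReal.ofReal_mul (by have := Real.pi_pos; positivity), basicTerm]
  congr 1
  have h1 := hp.lam_pos
  have h2 := hp.gam_pos
  have h3 := hp.K_pos
  -- The density `lam` cancels between the relays and the interferers.
  have h4 : (p.relayDensity * Real.pi) ^ m / p.bigLam ^ m =
      Real.pi ^ m * (1 - p.gam) ^ m / (p.gam ^ m * p.K ^ m) := by
    rw [← div_pow, ← mul_pow, ← mul_pow, ← div_pow]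
    congr 1
    unfold Params.relayDensity Params.bigLam
    field_simp
  rw [← h4, mul_div_assoc p.bigLam (p.R ^ 2)]
  field_simp

theorem Params.Valid.basicTerm_nonneg (hp : p.Valid) (n : Fin (m + 1) → ℕ) :
    0 ≤ basicTerm p n := by
  have h1 := hp.gam_pos
  have h2 := hp.K_pos
  have h3 := hp.G_pos
  have h4 : 0 < 1 - p.gam := sub_pos.2 hp.gam_lt_one
  have h5 := Real.pi_pos
  unfold basicTerm
  positivity

/-- Integral of a success probability that is a polynomial in the hop success probabilities. -/
theorem Params.Valid.lintegral_polynomial (hp : p.Valid) {Φ : (Fin (m + 1) → ℝ) → ℝ}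
    (F : Finset (Fin (m + 1) → ℕ)) (hF : ∀ n ∈ F, ∀ i, 1 ≤ n i) (c : (Fin (m + 1) → ℕ) → ℝ)
    (hΦ : ∀ γ, Φ γ = ∑ n ∈ F, c n * ∏ i, γ i ^ n i)
    (hΦ0 : ∀ γ : Fin (m + 1) → ℝ, (∀ i, γ i ∈ Set.Icc (0 : ℝ) 1) → 0 ≤ Φ γ) :
    0 ≤ ∑ n ∈ F, c n * basicTerm p n ∧
    ∫⁻ y, ENNReal.ofReal (Φ fun i => p.g0 (hopLength p y i))
        ∂Measure.pi (fun _ : Fin m => intensity p.relayDensity) =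
      ENNReal.ofReal (∑ n ∈ F, c n * basicTerm p n) := by
  have hm : ∀ n : Fin (m + 1) → ℕ, Measurable fun y : Fin m → Plane =>
      ∏ i, p.g0 (hopLength p y i) ^ n i := fun n =>
    Finset.measurable_fun_prod _ fun i _ =>
      ((continuous_g0 p).comp (continuous_hopLength p i)).measurable.pow_const _
  have h0 : ∀ (n : Fin (m + 1) → ℕ) (y : Fin m → Plane),
      0 ≤ ∏ i, p.g0 (hopLength p y i) ^ n i := fun n y =>
    Finset.prod_nonneg fun i _ => pow_nonneg (hp.g0_mem_Icc _).1 _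
  have hi : ∀ n ∈ F, Integrable (fun y => ∏ i, p.g0 (hopLength p y i) ^ n i)
      (Measure.pi fun _ : Fin m => intensity p.relayDensity) := fun n hn => by
    refine (lintegral_ofReal_ne_top_iff_integrable (hm n).aestronglyMeasurable
      (ae_of_all _ (h0 n))).1 ?_
    rw [hp.lintegral_monomial (hF n hn)]
    exact ENNReal.ofReal_ne_top
  have hv : ∀ n ∈ F, ∫ y, ∏ i, p.g0 (hopLength p y i) ^ n i
      ∂(Measure.pi fun _ : Fin m => intensity p.relayDensity) = basicTerm p n := fun n hn => by
    rw [integral_eq_lintegral_of_nonneg_ae (ae_of_all _ (h0 n)) (hm n).aestronglyMeasurable,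
      hp.lintegral_monomial (hF n hn), ENNReal.toReal_ofReal (hp.basicTerm_nonneg n)]
  have hΦ' : (fun y : Fin m → Plane => Φ fun i => p.g0 (hopLength p y i)) =
      fun y => ∑ n ∈ F, c n * ∏ i, p.g0 (hopLength p y i) ^ n i := funext fun y => hΦ _
  have hpos : ∀ y : Fin m → Plane, 0 ≤ Φ fun i => p.g0 (hopLength p y i) := fun y =>
    hΦ0 _ fun i => hp.g0_mem_Icc _
  have hI : ∫ y, Φ (fun i => p.g0 (hopLength p y i))
      ∂(Measure.pi fun _ : Fin m => intensity p.relayDensity) = ∑ n ∈ F, c n * basicTerm p n := by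
    rw [hΦ', integral_finsetSum _ fun n hn => (hi n hn).const_mul _]
    exact Finset.sum_congr rfl fun n hn => by rw [integral_const_mul, hv n hn]
  have hint : Integrable (fun y : Fin m → Plane => Φ fun i => p.g0 (hopLength p y i))
      (Measure.pi fun _ : Fin m => intensity p.relayDensity) := by
    rw [hΦ']
    exact integrable_finsetSum _ fun n hn => (hi n hn).const_mul _
  -- The sum may have terms of both signs; it is nonnegative as the integral of a probability.
  refine ⟨hI ▸ integral_nonneg hpos, ?_⟩
  rw [← hI, ofReal_integral_eq_lintegral_ofReal hint (ae_of_all _ hpos)]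

theorem singleMean_eq (hp : p.Valid) (m : ℕ) (D : ℝ) :
    singleMean p m D = (p.relayDensity * Real.pi) ^ m / (m + 1) *
      truncatedExp (p.G ^ (m + 1)) p.bigLam D m (p.R ^ 2 / (m + 1)) := by
  have h1 := hp.lam_pos
  have h2 := hp.gam_pos
  have h3 := hp.K_pos
  have h4 : p.G * p.kappa ^ m = (p.relayDensity * Real.pi) ^ m * (p.G ^ (m + 1) / p.bigLam ^ m) := by
    rw [pow_succ', mul_div_assoc, ← div_pow, mul_left_comm, ← mul_pow]
    congr 2
    unfold Params.kappa Params.relayDensity Params.bigLam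
    field_simp
  rw [singleMean, truncatedExp, h4]
  have h5 : p.bigLam * p.R ^ 2 / (m + 1) = p.bigLam * (p.R ^ 2 / (m + 1)) := mul_div_assoc _ _ _
  rw [h5]
  ring

theorem Params.Valid.singleMean_nonneg (hp : p.Valid) (m : ℕ) {D : ℝ}
    (hD : p.R ^ 2 / (m + 1) ≤ D) : 0 ≤ singleMean p m D := by
  rw [singleMean_eq hp]
  have := hp.relayDensity_nonneg
  have := Real.pi_pos
  exact mul_nonneg (by positivity)
    (truncatedExp_nonneg (pow_nonneg hp.G_pos.le _) hp.bigLam_pos m hD)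

/-- With all weights equal to one, the constraint and the success probability depend on the same
`routeEnergy`, so the integrand is an exponential cut off at `D`, and the reciprocals sum to `m +
1`. -/
theorem Params.Valid.lintegral_single (hp : p.Valid) {D : ℝ} (hD : p.R ^ 2 / (m + 1) ≤ D) :
    ∫⁻ y, ENNReal.ofReal ({r : Fin (m + 1) → ℝ | ∑ i, r i ^ 2 ≤ D}.indicator
        (fun r => ∏ i, p.g0 (r i)) (hopLength p y))
        ∂Measure.pi (fun _ : Fin m => intensity p.relayDensity) =
      ENNReal.ofReal (singleMean p m D) := by
  have hG := hp.G_pos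
  have hφ : Measurable ((Set.Iic D).indicator fun v : ℝ =>
      ENNReal.ofReal (p.G ^ (m + 1) * Real.exp (-(p.bigLam * v)))) :=
    Measurable.indicator (by fun_prop) measurableSet_Iic
  have hpt : ∀ y : Fin m → Plane, ENNReal.ofReal ({r : Fin (m + 1) → ℝ | ∑ i, r i ^ 2 ≤ D}.indicator
        (fun r => ∏ i, p.g0 (r i)) (hopLength p y)) =
      (Set.Iic D).indicator (fun v : ℝ =>
        ENNReal.ofReal (p.G ^ (m + 1) * Real.exp (-(p.bigLam * v))))
        (routeEnergy (fun _ => 1) !₂[-p.R / 2, 0] !₂[p.R / 2, 0] y) := by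
    intro y
    have h1 := prod_g0_pow p (fun _ : Fin (m + 1) => 1) y
    simp only [pow_one, Finset.sum_const, Finset.card_univ, Fintype.card_fin, smul_eq_mul,
      mul_one, Nat.cast_one] at h1
    have h2 := sum_mul_hopLength_sq p (fun _ : Fin (m + 1) => 1) y
    simp only [one_mul] at h2
    simp only [Set.indicator_apply, Set.mem_ofPred_eq, Set.mem_Iic, h1, h2]
    split_ifs <;> simp
  simp_rw [hpt]
  rw [lintegral_routeEnergy hp.relayDensity_nonneg (fun _ => one_pos) hφ,
    tailIntegral_iterate_truncated D hp.bigLam_pos (by positivity), sq_dist_source_dest]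
  simp only [Finset.prod_const_one, div_one, Finset.sum_const, Finset.card_univ, Fintype.card_fin,
    nsmul_eq_mul, mul_one, one_mul, Nat.cast_add, Nat.cast_one]
  -- `R² / (m + 1)` is the least possible sum of squared hop lengths; `hD` places it below the
  -- cutoff.
  rw [Set.indicator_of_mem (Set.mem_Iic.2 hD), ← ENNReal.ofReal_mul, ← singleMean_eq hp]
  have := hp.relayDensity_nonneg
  have := Real.pi_pos
  positivity

end Means

/-! ### Completion probabilities for single transmission and for retransmission. -/

section Completion

variable {Ω : Type*} [MeasurableSpace Ω] {P : Measure Ω} [IsProbabilityMeasure P] {m : ℕ}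
  {p : Params} {X : ℕ → Ω → Plane} {U : ℕ × Node × Node → Ω → ℝ}

omit [IsProbabilityMeasure P] in
theorem IsNetwork.measureReal_channel_le (hnet : IsNetwork p P X U) (q : ℕ × Node × Node) {γ : ℝ}
    (hγ : γ ∈ Set.Icc (0 : ℝ) 1) : P.real {ω | U q ω ≤ γ} = γ := by
  have h : P {ω | U q ω ≤ γ} = P.map (U q) (Set.Iic γ) := by
    rw [Measure.map_apply (hnet.channel_measurable q) measurableSet_Iic]
    rfl
  have h2 : Set.Iic γ ∩ Set.Icc 0 1 = Set.Icc 0 γ := by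
    ext x
    simp only [Set.mem_inter_iff, Set.mem_Iic, Set.mem_Icc]
    exact ⟨fun h => ⟨h.2.1, h.1⟩, fun h => ⟨h.2, h.1, h.2.trans hγ.2⟩⟩
  rw [measureReal_def, h, hnet.channel_law, Measure.restrict_apply measurableSet_Iic, h2,
    Real.volume_Icc, sub_zero, ENNReal.toReal_ofReal hγ.1]

open scoped Classical in
/-- Probability of a prescribed pattern `b` of successes and failures of the hops in finitely many
slots. -/
theorem IsNetwork.measureReal_pattern (hnet : IsNetwork p P X U)
    {hop : Fin (m + 1) → Node × Node} (hhop : Function.Injective hop) {γ : Fin (m + 1) → ℝ}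
    (hγ : ∀ i, γ i ∈ Set.Icc (0 : ℝ) 1) (B : Fin (m + 1) → Finset ℕ)
    (b : Fin (m + 1) → ℕ → Prop) :
    P.real {ω | ∀ i, ∀ t ∈ B i, U (t, hop i) ω ≤ γ i ↔ b i t} =
      ∏ i, ∏ t ∈ B i, if b i t then γ i else 1 - γ i := by
  let F : Finset (Fin (m + 1) × ℕ) := Finset.univ.biUnion fun i => (B i).image fun t => (i, t)
  have hF : ∀ q : Fin (m + 1) × ℕ, q ∈ F ↔ q.1 ∈ Finset.univ ∧ q.2 ∈ B q.1 := by
    rintro ⟨i, t⟩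
    simp only [F, Finset.mem_biUnion, Finset.mem_univ, true_and, Finset.mem_image, Prod.mk.injEq]
    constructor
    · rintro ⟨j, t', h1, rfl, rfl⟩
      exact h1
    · exact fun h => ⟨i, t, h, rfl, rfl⟩
  -- Distinct pairs of hop index and slot use distinct, hence independent, channels, even when hops
  -- share slots.
  have hinj : Function.Injective fun q : Fin (m + 1) × ℕ => (q.2, hop q.1) := by
    rintro ⟨i, t⟩ ⟨j, s⟩ h
    simp only [Prod.mk.injEq] at h
    rw [hhop h.2, h.1]
  let S : Fin (m + 1) × ℕ → Set ℝ := fun q => if b q.1 q.2 then Set.Iic (γ q.1) else Set.Ioi (γ q.1)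
  have hS : ∀ q, MeasurableSet (S q) := fun q => by
    simp only [S]
    split_ifs
    exacts [measurableSet_Iic, measurableSet_Ioi]
  have h : P (⋂ q ∈ F, (fun ω => U (q.2, hop q.1) ω) ⁻¹' S q) =
      ∏ q ∈ F, P ((fun ω => U (q.2, hop q.1) ω) ⁻¹' S q) :=
    (hnet.channel_indep.precomp hinj).meas_biInter fun q _ => ⟨S q, hS q, rfl⟩
  have hset : {ω | ∀ i, ∀ t ∈ B i, U (t, hop i) ω ≤ γ i ↔ b i t} =
      ⋂ q ∈ F, (fun ω => U (q.2, hop q.1) ω) ⁻¹' S q := by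
    ext ω
    simp only [Set.mem_ofPred_eq, Set.mem_iInter, hF, Finset.mem_univ, true_and, Prod.forall,
      Set.mem_preimage]
    refine forall_congr' fun i => forall_congr' fun t => forall_congr' fun _ => ?_
    by_cases hb : b i t <;> simp [S, hb]
  have hval : ∀ q : Fin (m + 1) × ℕ, (P ((fun ω => U (q.2, hop q.1) ω) ⁻¹' S q)).toReal =
      if b q.1 q.2 then γ q.1 else 1 - γ q.1 := by
    rintro ⟨i, t⟩
    have h1 := hnet.measureReal_channel_le (t, hop i) (hγ i)
    have hm : MeasurableSet {ω | U (t, hop i) ω ≤ γ i} :=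
      measurableSet_le (hnet.channel_measurable _) measurable_const
    by_cases hb : b i t
    · simp only [S, hb, if_true]
      exact h1
    · simp only [S, hb, if_false]
      have h2 := probReal_compl_eq_one_sub (μ := P) hm
      rw [h1] at h2
      rw [← h2, measureReal_def]
      congr 2
      ext ω
      simp
  rw [measureReal_def, hset, h, ENNReal.toReal_prod, Finset.prod_congr rfl fun q _ => hval q]
  exact Finset.prod_finset_product' F Finset.univ B hF (f := fun i t => if b i t then γ i else 1 - γ i)

/-- One transmission per hop. -/
theorem IsNetwork.isCompletionProb_single (hnet : IsNetwork p P X U) (s : Fin (m + 1) → ℕ) :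
    IsCompletionProb P U {s} fun γ => ∏ i, γ i := by
  classical
  intro hop hhop γ hγ
  have h := hnet.measureReal_pattern hhop hγ (fun i => {s i}) fun _ _ => True
  simpa using h

/-- Best-effort retransmission. -/
theorem IsNetwork.isCompletionProb_retrans (hnet : IsNetwork p P X U)
    (T : Fin (m + 1) → Finset ℕ) :
    IsCompletionProb P U (Fintype.piFinset T) fun γ => ∏ i, (1 - (1 - γ i) ^ (T i).card) := by
  classical
  intro hop hhop γ hγ
  let F : Fin (m + 1) → Set Ω := fun i => {ω | ∀ t ∈ T i, ¬ U (t, hop i) ω ≤ γ i}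
  have hFm : ∀ i, MeasurableSet (F i) := fun i => by
    have : F i = ⋂ t ∈ T i, {ω | U (t, hop i) ω ≤ γ i}ᶜ := by
      ext ω; simp [F]
    rw [this]
    exact Finset.measurableSet_biInter _ fun t _ =>
      (measurableSet_le (hnet.channel_measurable _) measurable_const).compl
  have hFP : ∀ s : Finset (Fin (m + 1)), P.real (⋂ i ∈ s, F i) =
      ∏ i ∈ s, (1 - γ i) ^ (T i).card := by
    intro s
    -- Empty slot sets outside `s` impose no condition, which gives the joint failure probability of
    -- any subfamily of hops.
    have h := hnet.measureReal_pattern hhop hγ (fun i => if i ∈ s then T i else ∅) fun _ _ => False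
    have hset : {ω | ∀ i, ∀ t ∈ (if i ∈ s then T i else ∅), U (t, hop i) ω ≤ γ i ↔ False} =
        ⋂ i ∈ s, F i := by
      ext ω
      simp only [Set.mem_ofPred_eq, Set.mem_iInter, F, iff_false]
      refine forall_congr' fun i => ?_
      by_cases hi : i ∈ s <;> simp [hi]
    rw [← hset, h, ← Finset.prod_subset (Finset.subset_univ s)]
    · refine Finset.prod_congr rfl fun i hi => ?_
      simp [hi]
    · intro i _ hi
      simp [hi]
  have hF1 : ∀ i, P.real (F i) = (1 - γ i) ^ (T i).card := fun i => by
    simpa using hFP {i}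
  have hind : iIndepSet F P := by
    rw [iIndepSet_iff_meas_biInter hFm]
    intro s
    rw [← ENNReal.toReal_eq_toReal_iff' (measure_ne_top _ _)
      (ENNReal.prod_ne_top fun i _ => measure_ne_top _ _), ENNReal.toReal_prod]
    exact (hFP s).trans (Finset.prod_congr rfl fun i _ => (hF1 i).symm)
  have hset : {ω | ∃ t ∈ Fintype.piFinset T, ∀ i, U (t i, hop i) ω ≤ γ i} = ⋂ i, (F i)ᶜ := by
    ext ω
    simp only [Set.mem_ofPred_eq, Fintype.mem_piFinset, Set.mem_iInter, F, Set.mem_compl_iff,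
      not_forall, not_not]
    constructor
    · rintro ⟨t, ht, h⟩ i
      exact ⟨t i, ht i, h i⟩
    · intro h
      choose t ht h using h
      exact ⟨t, ht, h⟩
  rw [hset, measureReal_def, ((iIndepSet_iff_iIndep F P).1 hind).meas_iInter fun i =>
    MeasurableSet.compl (MeasurableSpace.measurableSet_generateFrom rfl), ENNReal.toReal_prod]
  refine Finset.prod_congr rfl fun i _ => ?_
  rw [← hF1 i, ← probReal_compl_eq_one_sub (hFm i)]
  rfl

end Completion

/-! ### Greedy slots, and the completion probability under a total budget. -/

section FirstSuccess

/-- Number of slots used before hop `i`, when hop `l` uses `j l` slots. -/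
def slotsBefore {n : ℕ} (j : Fin n → ℕ) (i : Fin n) : ℕ := ∑ l, if l < i then j l else 0

theorem slotsBefore_zero {n : ℕ} (j : Fin (n + 1) → ℕ) : slotsBefore j 0 = 0 := by
  simp [slotsBefore]

theorem slotsBefore_succ {n : ℕ} (j : Fin (n + 1) → ℕ) (i : Fin n) :
    slotsBefore j i.succ = j 0 + slotsBefore (fun l => j l.succ) i := by
  simp [slotsBefore, Fin.sum_univ_succ]

/-- Starting in slot `a`, hop `i` is attempted `j i` times and succeeds in the last attempt
only. -/
def FirstSuccess {n : ℕ} (S : Fin n → ℕ → Prop) (a : ℕ) (j : Fin n → ℕ) : Prop :=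
  ∀ i, ∀ t ∈ Finset.Ico (a + slotsBefore j i) (a + slotsBefore j i + j i),
    S i t ↔ t + 1 = a + slotsBefore j i + j i

theorem firstSuccess_succ {n : ℕ} {S : Fin (n + 1) → ℕ → Prop} {a : ℕ} {j : Fin (n + 1) → ℕ} :
    FirstSuccess S a j ↔ (∀ t ∈ Finset.Ico a (a + j 0), S 0 t ↔ t + 1 = a + j 0) ∧
      FirstSuccess (fun i => S i.succ) (a + j 0) fun i => j i.succ := by
  simp only [FirstSuccess, Fin.forall_fin_succ, slotsBefore_zero, slotsBefore_succ, add_zero,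
    zero_add, add_assoc]

theorem FirstSuccess.unique {n : ℕ} {S : Fin n → ℕ → Prop} {a : ℕ} {j j' : Fin n → ℕ}
    (h : FirstSuccess S a j) (h' : FirstSuccess S a j') (hj : ∀ i, 1 ≤ j i)
    (hj' : ∀ i, 1 ≤ j' i) : j = j' := by
  induction n generalizing a with
  | zero => exact Subsingleton.elim _ _
  | succ n ih =>
    rw [firstSuccess_succ] at h h'
    -- If `c < d`, slot `a + c - 1` would be a success by the first description and a failure by the
    -- second.
    have key : ∀ {c d : ℕ}, 1 ≤ c → (∀ t ∈ Finset.Ico a (a + c), S 0 t ↔ t + 1 = a + c) →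
        (∀ t ∈ Finset.Ico a (a + d), S 0 t ↔ t + 1 = a + d) → d ≤ c := by
      intro c d hc h1 h2
      by_contra hlt
      have h3 := (h1 (a + c - 1) (Finset.mem_Ico.2 (by omega))).2 (by omega)
      have h4 := (h2 (a + c - 1) (Finset.mem_Ico.2 (by omega))).1 h3
      omega
    have h0 : j 0 = j' 0 := le_antisymm (key (hj' 0) h'.1 h.1) (key (hj 0) h.1 h'.1)
    have h1 := h'.2
    rw [← h0] at h1
    have ht := ih h.2 h1 (fun i => hj _) (fun i => hj' _)
    funext i
    induction i using Fin.cases with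
    | zero => exact h0
    | succ i => exact congrFun ht i

/-- Increasing slots of success exist iff the greedy choice of the slots works. -/
theorem exists_strictMono_iff_firstSuccess {n : ℕ} (S : Fin n → ℕ → Prop) (a b : ℕ) (hab : a ≤ b) :
    (∃ t : Fin n → ℕ, StrictMono t ∧ (∀ i, a ≤ t i ∧ t i < b) ∧ ∀ i, S i (t i)) ↔
      ∃ j : Fin n → ℕ, (∀ i, 1 ≤ j i) ∧ a + ∑ i, j i ≤ b ∧ FirstSuccess S a j := by
  classical
  induction n generalizing a with
  | zero =>
    refine ⟨fun _ => ⟨fun i => i.elim0, fun i => i.elim0, by simpa using hab, fun i => i.elim0⟩,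
      fun _ => ⟨fun i => i.elim0, fun i => i.elim0, fun i => i.elim0, fun i => i.elim0⟩⟩
  | succ n ih =>
    constructor
    · rintro ⟨t, ht, htab, htS⟩
      -- Replacing `t 0` by the first success of hop `0` keeps the later slots admissible, since
      -- they lie beyond `t 0`.
      have hex : ∃ s, a ≤ s ∧ S 0 s := ⟨t 0, (htab 0).1, htS 0⟩
      have hle : Nat.find hex ≤ t 0 := Nat.find_min' hex ⟨(htab 0).1, htS 0⟩
      have hs := Nat.find_spec hex
      have hmin : ∀ s, s < Nat.find hex → a ≤ s → ¬ S 0 s := fun s h1 h2 h3 =>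
        Nat.find_min hex h1 ⟨h2, h3⟩
      generalize Nat.find hex = s₀ at *
      have htb := (htab 0).2
      obtain ⟨j, hj1, hjb, hjS⟩ := (ih (fun i => S i.succ) (s₀ + 1) (by omega)).1
        ⟨fun i => t i.succ, fun i k hik => ht (Fin.succ_lt_succ_iff.2 hik), fun i => by
          have := ht (Fin.succ_pos i)
          exact ⟨show s₀ + 1 ≤ t i.succ by omega, (htab _).2⟩, fun i => htS _⟩
      refine ⟨Fin.cons (s₀ + 1 - a) j, ?_, ?_, ?_⟩
      · intro i
        induction i using Fin.cases with
        | zero => simp only [Fin.cons_zero]; omega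
        | succ i => exact hj1 i
      · rw [Fin.sum_univ_succ]
        simp only [Fin.cons_zero, Fin.cons_succ]
        omega
      · rw [firstSuccess_succ]
        simp only [Fin.cons_zero, Fin.cons_succ]
        rw [show a + (s₀ + 1 - a) = s₀ + 1 by omega]
        refine ⟨fun t' ht' => ?_, hjS⟩
        rw [Finset.mem_Ico] at ht'
        constructor
        · intro hS
          by_contra hne
          exact hmin t' (by omega) ht'.1 hS
        · intro he
          rw [show t' = s₀ by omega]
          exact hs.2
    · rintro ⟨j, hj1, hjb, hjS⟩
      rw [firstSuccess_succ] at hjS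
      rw [Fin.sum_univ_succ] at hjb
      have h0 := hj1 0
      obtain ⟨t, ht, htab, htS⟩ := (ih (fun i => S i.succ) (a + j 0) (by omega)).2
        ⟨fun i => j i.succ, fun i => hj1 _,
          show a + j 0 + ∑ i : Fin n, j i.succ ≤ b by omega, hjS.2⟩
      refine ⟨Fin.cons (a + j 0 - 1) t, ?_, ?_, ?_⟩
      · intro i k hik
        induction k using Fin.cases with
        | zero => exact absurd hik (Fin.not_lt_zero i)
        | succ k =>
          induction i using Fin.cases with
          | zero =>
            simp only [Fin.cons_zero, Fin.cons_succ]
            have := (htab k).1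
            omega
          | succ i => exact ht (Fin.succ_lt_succ_iff.1 hik)
      · intro i
        induction i using Fin.cases with
        | zero => simp only [Fin.cons_zero]; omega
        | succ i =>
          simp only [Fin.cons_succ]
          have := htab i
          omega
      · intro i
        induction i using Fin.cases with
        | zero =>
          simp only [Fin.cons_zero]
          exact (hjS.1 _ (Finset.mem_Ico.2 (by omega))).2 (by omega)
        | succ i => exact htS i

theorem mem_vectors {m : ℕ} {k : Fin (m + 1) → ℕ} {M : ℕ} {j : Fin (m + 1) → ℕ} :
    j ∈ vectors k M ↔ (∀ i, k i ≤ j i) ∧ ∑ i, j i ≤ M := by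
  simp only [vectors, Finset.mem_filter, Fintype.mem_piFinset, Finset.mem_Icc]
  refine ⟨fun h => ⟨fun i => (h.1 i).1, h.2⟩, fun h => ⟨fun i => ⟨h.1 i, ?_⟩, h.2⟩⟩
  exact (Finset.single_le_sum (f := j) (fun _ _ => Nat.zero_le _) (Finset.mem_univ i)).trans h.2

variable {Ω : Type*} [MeasurableSpace Ω] {P : Measure Ω} [IsProbabilityMeasure P] {m : ℕ}
  {p : Params} {X : ℕ → Ω → Plane} {U : ℕ × Node × Node → Ω → ℝ}

open scoped Classical in
/-- The increasing vectors of slots in `{0, …, M - 1}`. -/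
noncomputable def increasingSlots (m M : ℕ) : Finset (Fin (m + 1) → ℕ) :=
  (Fintype.piFinset fun _ => Finset.range M).filter StrictMono

/-- At most `M` attempts in total. -/
theorem IsNetwork.isCompletionProb_total (hnet : IsNetwork p P X U) (M : ℕ) :
    IsCompletionProb P U (increasingSlots m M) fun γ =>
      ∑ j ∈ vectors (fun _ : Fin (m + 1) => 1) M, ∏ i, γ i * (1 - γ i) ^ (j i - 1) := by
  classical
  intro hop hhop γ hγ
  let A : (Fin (m + 1) → ℕ) → Set Ω := fun j =>
    {ω | FirstSuccess (fun i t => U (t, hop i) ω ≤ γ i) 0 j}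
  have hset : {ω | ∃ t ∈ increasingSlots m M, ∀ i, U (t i, hop i) ω ≤ γ i} =
      ⋃ j ∈ vectors (fun _ : Fin (m + 1) => 1) M, A j := by
    ext ω
    have h := exists_strictMono_iff_firstSuccess
      (fun (i : Fin (m + 1)) t => U (t, hop i) ω ≤ γ i) 0 M (Nat.zero_le M)
    simp only [Set.mem_ofPred_eq, increasingSlots, Finset.mem_filter, Fintype.mem_piFinset,
      Finset.mem_range, Set.mem_iUnion, mem_vectors, A, exists_prop]
    simp only [Nat.zero_le, true_and, zero_add] at h
    constructor
    · rintro ⟨t, ⟨h1, h2⟩, h3⟩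
      obtain ⟨j, h4, h5, h6⟩ := h.1 ⟨t, h2, h1, h3⟩
      exact ⟨j, ⟨h4, h5⟩, h6⟩
    · rintro ⟨j, ⟨h4, h5⟩, h6⟩
      obtain ⟨t, h2, h1, h3⟩ := h.2 ⟨j, h4, h5, h6⟩
      exact ⟨t, ⟨h1, h2⟩, h3⟩
  have hAm : ∀ j, MeasurableSet (A j) := by
    intro j
    have : A j = ⋂ i, ⋂ t ∈ Finset.Ico (0 + slotsBefore j i) (0 + slotsBefore j i + j i),
        {ω | U (t, hop i) ω ≤ γ i ↔ t + 1 = 0 + slotsBefore j i + j i} := by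
      ext ω; simp [A, FirstSuccess]
    rw [this]
    refine MeasurableSet.iInter fun i => Finset.measurableSet_biInter _ fun t _ => ?_
    exact (measurableSet_le (hnet.channel_measurable _) measurable_const).iff
      (MeasurableSet.const _)
  rw [hset, measureReal_biUnion_finset]
  · refine Finset.sum_congr rfl fun j hj => ?_
    refine (hnet.measureReal_pattern hhop hγ _ _).trans (Finset.prod_congr rfl fun i _ => ?_)
    have hji := (mem_vectors.1 hj).1 i
    obtain ⟨e, he⟩ : ∃ e, j i = e + 1 := ⟨j i - 1, by omega⟩
    -- The last of the `j i` attempts succeeds and the `j i - 1` before it fail.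
    rw [he, ← add_assoc, Finset.prod_Ico_succ_top (by omega), if_pos rfl, mul_comm]
    congr 1
    refine (Finset.prod_congr rfl fun t ht => if_neg ?_).trans ?_
    · rw [Finset.mem_Ico] at ht
      omega
    · simp
  -- The greedy attempt counts are unique, so the events are disjoint and their probabilities add.
  · intro j hj j' hj' hne
    refine Set.disjoint_left.2 fun ω h1 h2 => hne ?_
    exact FirstSuccess.unique h1 h2 (mem_vectors.1 hj).1 (mem_vectors.1 hj').1
  · exact fun j _ => hAm j

end FirstSuccess

/-! ### Expanding the completion probabilities into monomials. -/

section Polynomials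

variable {m : ℕ}

theorem one_sub_one_sub_pow (x : ℝ) (k : ℕ) :
    1 - (1 - x) ^ k = ∑ n ∈ Finset.Icc 1 k, (-1) ^ (n + 1) * (k.choose n : ℝ) * x ^ n := by
  have h : (1 - x) ^ k = ∑ n ∈ Finset.range (k + 1), (-x) ^ n * (k.choose n : ℝ) := by
    rw [sub_eq_neg_add, add_pow]
    simp
  rw [h, Finset.range_eq_Ico, Finset.sum_eq_sum_Ico_succ_bot (Nat.succ_pos k)]
  simp only [pow_zero, Nat.choose_zero_right, Nat.cast_one, mul_one, zero_add]
  rw [sub_add_cancel_left, ← Finset.sum_neg_distrib]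
  refine Finset.sum_congr rfl fun n _ => ?_
  rw [neg_pow]
  ring

theorem mul_one_sub_pow (x : ℝ) {j : ℕ} (hj : 1 ≤ j) :
    x * (1 - x) ^ (j - 1) =
      ∑ k ∈ Finset.Icc 1 j, (-1) ^ (k + 1) * ((j - 1).choose (k - 1) : ℝ) * x ^ k := by
  obtain ⟨e, rfl⟩ : ∃ e, j = e + 1 := ⟨j - 1, by omega⟩
  rw [Nat.add_sub_cancel, sub_eq_neg_add, add_pow, Finset.mul_sum]
  have hIcc : Finset.Icc 1 (e + 1) = Finset.Ico (0 + 1) (e + 1 + 1) := rfl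
  rw [hIcc, ← Finset.sum_Ico_add', ← Finset.range_eq_Ico]
  refine Finset.sum_congr rfl fun k _ => ?_
  rw [Nat.add_sub_cancel, neg_pow]
  ring

/-- Each of the `m + 1` factors contributes a sign `(-1) ^ (n i + 1)`, which yields the exponent `m
+ 1 + ∑ n i`. -/
theorem prod_sum_signed (s : Fin (m + 1) → Finset ℕ) (c : Fin (m + 1) → ℕ → ℝ)
    (γ : Fin (m + 1) → ℝ) :
    ∏ i, ∑ n ∈ s i, (-1) ^ (n + 1) * c i n * γ i ^ n =
      ∑ n ∈ Fintype.piFinset s, (-1) ^ (m + 1 + ∑ i, n i) * (∏ i, c i (n i)) *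
        ∏ i, γ i ^ n i := by
  rw [Finset.prod_univ_sum]
  refine Finset.sum_congr rfl fun n _ => ?_
  rw [Finset.prod_mul_distrib, Finset.prod_mul_distrib, Finset.prod_pow_eq_pow_sum,
    Finset.sum_add_distrib]
  simp [add_comm]

theorem retrans_polynomial (k : Fin (m + 1) → ℕ) (γ : Fin (m + 1) → ℝ) :
    ∏ i, (1 - (1 - γ i) ^ k i) = ∑ n ∈ Fintype.piFinset fun i => Finset.Icc 1 (k i),
      (-1) ^ (m + 1 + ∑ i, n i) * (∏ i, ((k i).choose (n i) : ℝ)) * ∏ i, γ i ^ n i := by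
  simp_rw [one_sub_one_sub_pow]
  exact prod_sum_signed _ (fun i n => ((k i).choose n : ℝ)) γ

theorem total_polynomial (M : ℕ) (γ : Fin (m + 1) → ℝ) :
    ∑ j ∈ vectors (fun _ : Fin (m + 1) => 1) M, ∏ i, γ i * (1 - γ i) ^ (j i - 1) =
      ∑ k ∈ vectors (fun _ : Fin (m + 1) => 1) M, (-1) ^ (m + 1 + ∑ i, k i) *
        (∑ j ∈ vectors k M, ∏ i, ((j i - 1).choose (k i - 1) : ℝ)) * ∏ i, γ i ^ k i := by
  have h : ∀ j ∈ vectors (fun _ : Fin (m + 1) => 1) M, ∏ i, γ i * (1 - γ i) ^ (j i - 1) =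
      ∑ k ∈ Fintype.piFinset fun i => Finset.Icc 1 (j i), (-1) ^ (m + 1 + ∑ i, k i) *
        (∏ i, ((j i - 1).choose (k i - 1) : ℝ)) * ∏ i, γ i ^ k i := by
    intro j hj
    rw [Finset.prod_congr rfl fun i _ => mul_one_sub_pow (γ i) ((mem_vectors.1 hj).1 i)]
    exact prod_sum_signed _ (fun i n => ((j i - 1).choose (n - 1) : ℝ)) γ
  rw [Finset.sum_congr rfl h]
  simp_rw [Finset.mul_sum, Finset.sum_mul]
  -- Both orders of summation run over the pairs `1 ≤ k ≤ j` with `∑ j i ≤ M`; the bound on `∑ k i`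
  -- then follows.
  refine Finset.sum_comm' fun j k => ?_
  simp only [mem_vectors, Fintype.mem_piFinset, Finset.mem_Icc]
  constructor
  · rintro ⟨⟨-, h2⟩, h3⟩
    exact ⟨⟨fun i => (h3 i).2, h2⟩, fun i => (h3 i).1,
      (Finset.sum_le_sum fun i _ => (h3 i).2).trans h2⟩
  · rintro ⟨⟨h1, h2⟩, h3, -⟩
    exact ⟨⟨fun i => (h3 i).trans (h1 i), h2⟩, fun i => ⟨h3 i, h1 i⟩⟩

end Polynomials

/-! ### The three forwarding schemes as instances of `routeSets`. -/

section Schemes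

variable {Ω : Type*} {m : ℕ} {p : Params} {X : ℕ → Ω → Plane} {U : ℕ × Node × Node → Ω → ℝ}

theorem singleSets_eq (D : ℝ) (s : Fin (m + 1) → ℕ) :
    singleSets p X U D s = routeSets p X U {r | ∑ i, r i ^ 2 ≤ D} {s} := by
  funext ω
  ext z
  simp [singleSets, routeSets, routeSqDist, dist_pos_hop]

theorem retransSets_eq (T : Fin (m + 1) → Finset ℕ) :
    retransSets p X U T = routeSets p X U Set.univ (Fintype.piFinset T) := by
  funext ω
  ext z
  simp only [retransSets, routeSets, Set.mem_ofPred_eq, Set.mem_univ, true_and,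
    Fintype.mem_piFinset]
  refine and_congr_right fun _ => ⟨fun h => ?_, ?_⟩
  · choose t ht h using h
    exact ⟨t, ht, h⟩
  · rintro ⟨t, ht, h⟩ i
    exact ⟨t i, ht i, h i⟩

theorem totalSets_eq (M : ℕ) :
    totalSets p X U m M = routeSets p X U Set.univ (increasingSlots m M) := by
  funext ω
  ext z
  simp only [totalSets, routeSets, increasingSlots, Set.mem_ofPred_eq, Set.mem_univ, true_and,
    Finset.mem_filter, Fintype.mem_piFinset, Finset.mem_range]
  refine and_congr_right fun _ => ⟨?_, ?_⟩
  · rintro ⟨t, ht, h⟩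
    exact ⟨fun i => t i, ⟨fun i => (t i).2, fun i k hik => ht hik⟩, h⟩
  · rintro ⟨t, ⟨ht, hmono⟩, h⟩
    exact ⟨fun i => ⟨t i, ht i⟩, fun i k hik => hmono hik, h⟩

variable [MeasurableSpace Ω] {P : Measure Ω} [IsProbabilityMeasure P]

/-- The case of no distance constraint and a polynomial success probability. -/
theorem IsNetwork.mean_and_outage_polynomial (hnet : IsNetwork p P X U) (hp : p.Valid)
    (hm : 1 ≤ m) {T : Finset (Fin (m + 1) → ℕ)} {Φ : (Fin (m + 1) → ℝ) → ℝ}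
    (hΦ : IsCompletionProb P U T Φ) (F : Finset (Fin (m + 1) → ℕ)) (hF : ∀ n ∈ F, ∀ i, 1 ≤ n i)
    (c : (Fin (m + 1) → ℕ) → ℝ) (hpoly : ∀ γ, Φ γ = ∑ n ∈ F, c n * ∏ i, γ i ^ n i) :
    expectedNumber P (routeSets p X U Set.univ T) =
        ENNReal.ofReal (∑ n ∈ F, c n * basicTerm p n) ∧
      Real.exp (-∑ n ∈ F, c n * basicTerm p n) ≤ outageProb P (routeSets p X U Set.univ T) := by
  obtain ⟨h0, hI⟩ := hp.lintegral_polynomial F hF c hpoly fun γ hγ => (hΦ.mem_Icc hγ).1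
  have hc : Continuous Φ := by
    rw [funext hpoly]
    fun_prop
  refine hnet.mean_and_outage hp hm isClosed_univ (fun _ _ _ _ => Set.mem_univ _) hΦ hc h0 ?_
  simpa only [Set.indicator_univ] using hI

end Schemes

end Multihop

theorem corollary1 {Ω : Type*} [MeasurableSpace Ω] (P : Measure Ω) [IsProbabilityMeasure P]
    (p : Multihop.Params) (hlam : 0 < p.lam) (hgam0 : 0 < p.gam) (hgam1 : p.gam < 1)
    (hG0 : 0 < p.G) (hG1 : p.G ≤ 1) (hK : 0 < p.K) (hR : 0 ≤ p.R)
    (X : ℕ → Ω → Multihop.Plane) (U : ℕ × Multihop.Node × Multihop.Node → Ω → ℝ)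
    (hnet : Multihop.IsNetwork p P X U) (m : ℕ) (hm : 1 ≤ m) :
    (∀ (D : ℝ), p.R ^ 2 / (m + 1) ≤ D → ∀ s : Fin (m + 1) → ℕ,
      Multihop.expectedNumber P (Multihop.singleSets p X U D s) =
          ENNReal.ofReal (Multihop.singleMean p m D) ∧
        Real.exp (-Multihop.singleMean p m D) ≤
          Multihop.outageProb P (Multihop.singleSets p X U D s)) ∧
    (∀ (k : Fin (m + 1) → ℕ) (T : Fin (m + 1) → Finset ℕ), (∀ i, (T i).card = k i) →
      Multihop.expectedNumber P (Multihop.retransSets p X U T) =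
          ENNReal.ofReal (Multihop.retransMean p k) ∧
        Real.exp (-Multihop.retransMean p k) ≤
          Multihop.outageProb P (Multihop.retransSets p X U T)) ∧
    (∀ M : ℕ,
      Multihop.expectedNumber P (Multihop.totalSets p X U m M) =
          ENNReal.ofReal (Multihop.totalMean p m M) ∧
        Real.exp (-Multihop.totalMean p m M) ≤
          Multihop.outageProb P (Multihop.totalSets p X U m M)) := by
  have hp : p.Valid := ⟨hlam, hgam0, hgam1, hG0, hG1, hK⟩
  refine ⟨fun D hD s => ?_, fun k T hT => ?_, fun M => ?_⟩
  · rw [Multihop.singleSets_eq]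
    refine hnet.mean_and_outage hp hm ?_ ?_ (hnet.isCompletionProb_single s) (by fun_prop)
      (hp.singleMean_nonneg m hD) (hp.lintegral_single hD)
    · exact isClosed_le (by fun_prop) continuous_const
    · intro r r' h hr
      exact (Finset.sum_le_sum fun i _ => pow_le_pow_left₀ (h i).1 (h i).2 2).trans hr
  · rw [Multihop.retransSets_eq]
    refine hnet.mean_and_outage_polynomial hp hm (hnet.isCompletionProb_retrans T) _
      (fun n hn i => (Finset.mem_Icc.1 (Fintype.mem_piFinset.1 hn i)).1) _ fun γ => ?_
    simp_rw [hT]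
    exact Multihop.retrans_polynomial k γ
  · rw [Multihop.totalSets_eq]
    exact hnet.mean_and_outage_polynomial hp hm (hnet.isCompletionProb_total M) _
      (fun n hn i => (Multihop.mem_vectors.1 hn).1 i) _ fun γ => Multihop.total_polynomial M γ
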